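/- For integers $n, L\ge 1$ let $\mathcal G_{n,L}$ be the class of all planar graphs on $n$ vertices (finite, undirected, simple, with strictly positive integer edge weights) in which, for every two vertices $u,v$, the number of distinct shortest $u$-to-$v$ paths is less than $2^L$, i.e. has at most $L$ bits. (This number is $0$ if $v$ is not reachable from $u$.) A labeling scheme for counting shortest paths in $\mathcal G_{n,L}$ consists of an arbitrary function assigning to each $G\in\mathcal G_{n,L}$ and each vertex $u$ of $G$ a finite bit string $\ell_G(u)$, and an arbitrary decoding function $D$ such that for all $G\in\mathcal G_{n,L}$ and all vertices $u,v$ of $G$, the number of shortest $u$-to-$v$ paths in $G$ equals $D(\ell_G(u),\ell_G(v))$. **Theorem.** There is an absolute constant $c>0$ such that for all integers $n,L$ with $2\le L\le n$ and every labeling scheme for counting shortest paths in $\mathcal G_{n,L}$, there are a graph $G\in\mathcal G_{n,L}$ and a vertex $u$ of $G$ whose label has length at least $c\sqrt{nL}$ bits. That is, labels of $\Omega(\sqrt{nL})$ bits are required. (Consequently the same bound holds for labeling schemes that are correct on any larger class of graphs, for example directed planar graphs, planar multigraphs, or arbitrary non-negative real weights.) -/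

import Mathlib

open scoped unitInterval

/-- A planar embedding of a simple graph: vertices are distinct points of the plane, every edge is
a simple arc joining its two end-vertices, an arc contains no vertex other than its own ends, and
two different arcs meet only in (common) vertices. -/
structure PlaneEmbedding {V : Type*} (G : SimpleGraph V) where
  point : V → ℝ × ℝ
  arc : G.edgeSet → C(I, ℝ × ℝ)
  point_injective : Function.Injective point
  arc_injective : ∀ e, Function.Injective (arc e)
  arc_ends : ∀ e, s(arc e 0, arc e 1) = (e : Sym2 V).map point
  mem_of_arc_eq_point : ∀ e t v, arc e t = point v → v ∈ (e : Sym2 V)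
  arc_inter : ∀ e e', e ≠ e' → ∀ t t', arc e t = arc e' t' → ∃ v, arc e t = point v

/-- A graph is planar if it can be embedded in the plane. -/
def IsPlanar {V : Type*} (G : SimpleGraph V) : Prop :=
  Nonempty (PlaneEmbedding G)

/-- A simple undirected graph whose edges carry positive integer weights. (The values of `weight`
outside the edge set play no role.) -/
structure WeightedGraph (V : Type*) where
  graph : SimpleGraph V
  weight : Sym2 V → ℕ
  weight_pos : ∀ e ∈ graph.edgeSet, 0 < weight e

namespace WeightedGraph

variable {V : Type*} (G : WeightedGraph V)

/-- The length of a walk: the sum of the weights of its edges. -/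
def walkLength {u v : V} (p : G.graph.Walk u v) : ℕ :=
  (p.edges.map G.weight).sum

/-- The set of shortest `u`-to-`v` paths. -/
def shortestPaths (u v : V) : Set (G.graph.Walk u v) :=
  {p | p.IsPath ∧ ∀ q : G.graph.Walk u v, q.IsPath → G.walkLength p ≤ G.walkLength q}

/-- In a finite graph there are only finitely many shortest `u`-to-`v` paths. -/
theorem shortestPaths_finite [Finite V] (u v : V) : (G.shortestPaths u v).Finite := by
  have := Fintype.ofFinite V
  refine Set.Finite.of_injOn (f := fun p => p.support) (t := {l : List V | l.length ≤ Fintype.card V})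
    (fun p hp => ?_) (fun p _ q _ h => SimpleGraph.Walk.ext_support h) (List.finite_length_le V _)
  have := hp.1.length_lt
  change p.support.length ≤ _
  rw [SimpleGraph.Walk.length_support]
  omega

/-- The number of shortest `u`-to-`v` paths; it is `0` if `v` cannot be reached from `u`. -/
noncomputable def numShortestPaths (u v : V) : ℕ :=
  (G.shortestPaths u v).ncard

/-- The weighted graph is planar, and for any two vertices the number of shortest paths between
them is a number of at most `L` bits. -/
def IsPlanarWithCountBits (L : ℕ) : Prop :=
  IsPlanar G.graph ∧ ∀ u v, G.numShortestPaths u v < 2 ^ L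

end WeightedGraph

/-- A labeling scheme for counting shortest paths in weighted planar graphs with `n` vertices in
which all numbers of shortest paths have at most `L` bits: given the graph, every vertex receives
a bit string, and the number of shortest `u`-to-`v` paths is recovered from the labels of `u` and
`v` alone. The labels and the decoder are arbitrary functions, which may depend on `n` and `L`. -/
structure CountingLabelingScheme (n L : ℕ) where
  label : WeightedGraph (Fin n) → Fin n → List Bool
  decode : List Bool → List Bool → ℕ
  correct : ∀ G : WeightedGraph (Fin n), G.IsPlanarWithCountBits L →
    ∀ u v, decode (label G u) (label G v) = G.numShortestPaths u v

/-! The bound comes from counting: a family of planar graphs is built in which `2 * k` labels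
determine about `r * k ^ 2` independent bits.

Take a grid with `k + 1` rows and columns. Horizontal edges of row `i` cost `i + 1` and vertical
edges cost `V = vertWeight k r`, more than any horizontal saving. So the shortest route between two
grid vertices moves horizontally in the upper of their two rows and vertically in the column of the
lower one. Each cell `(i, j)` carries a gadget from its upper left to its lower right corner,
through which every shortest route costs `V + i + 1`, the same as going right and then down. Going
down and right to a target, a gadget is competitive only in the row of the source and in the column
just before the target; hence from row `i` to a lower vertex of column `j + 1` there are `x i j + 1`
shortest paths (`numShortestPaths_lower_right`), where `x i j` is the number of routes through the
gadget.

The gadget is a chain `2 * r, ..., 1, 0` ending in the lower right corner. Two units down from an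
even vertex can be made as two unit steps or one skip, so `2 ^ t` routes lead from `2 * t` to `0`.
An edge from the upper left corner to `2 * t` for each binary digit one of `x i j` gives exactly `x
i j` routes (`count_gadget`).

All other counts must have at most `L` bits as well. Setting the top digit makes the whole chain
part of a shortest path between the corners, which bounds counts inside a gadget; a gadget is left
only through its corners, so every count is at most `2 ^ (3 * r + 5)` (`numShortestPaths_lt`).

The labels of `k` vertices of the first column and `k` of the last row recover all `k ^ 2` numbers,
so labels have at least about `r * k` bits (`max_mul_le_of_length_le`). With `r` of order `L` and
`k` of order `√(n / L)` this is `Ω(√(n * L))`. -/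

namespace WeightedGraph

/-! ### Shortest paths in weighted graphs and bounds on their number. -/

variable {V : Type*} (G : WeightedGraph V)

@[simp] theorem walkLength_nil (u : V) : G.walkLength (.nil : G.graph.Walk u u) = 0 := by
  simp [walkLength]

@[simp] theorem walkLength_cons {u v w : V} (h : G.graph.Adj u v) (p : G.graph.Walk v w) :
    G.walkLength (.cons h p) = G.weight s(u, v) + G.walkLength p := by
  simp [walkLength]

@[simp] theorem walkLength_append {u v w : V} (p : G.graph.Walk u v) (q : G.graph.Walk v w) :
    G.walkLength (p.append q) = G.walkLength p + G.walkLength q := by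
  simp [walkLength]

@[simp] theorem walkLength_reverse {u v : V} (p : G.graph.Walk u v) :
    G.walkLength p.reverse = G.walkLength p := by
  simp [walkLength, List.sum_reverse]

/-- Cutting out a closed detour strictly shortens a walk, because weights are positive. -/
theorem isPath_of_forall_walkLength_le {u v : V} (p : G.graph.Walk u v)
    (h : ∀ q : G.graph.Walk u v, G.walkLength p ≤ G.walkLength q) : p.IsPath := by
  classical
  induction p with
  | nil => simp
  | @cons u w v e p ih =>
    have hw := G.weight_pos s(u, w) e
    refine (SimpleGraph.Walk.cons_isPath_iff e p).2 ⟨ih fun q => ?_, fun hu => ?_⟩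
    · simpa using h (.cons e q)
    · have h1 := congrArg G.walkLength (p.take_spec hu)
      have h2 := h (p.dropUntil u hu)
      simp only [walkLength_append, walkLength_cons] at h1 h2
      omega

/-- Walks can be concatenated freely while paths cannot, so minimality among walks is the usable
form. A walk of least length is a path, hence both minima agree. -/
theorem mem_shortestPaths_iff {u v : V} {p : G.graph.Walk u v} :
    p ∈ G.shortestPaths u v ↔ ∀ q : G.graph.Walk u v, G.walkLength p ≤ G.walkLength q := by
  refine ⟨fun hp q => ?_, fun h => ⟨G.isPath_of_forall_walkLength_le p h, fun q _ => h q⟩⟩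
  obtain ⟨m, -, hm⟩ := WellFounded.has_min (measure fun q : G.graph.Walk u v => G.walkLength q).wf
    Set.univ ⟨q, trivial⟩
  have hm' : ∀ q, G.walkLength m ≤ G.walkLength q := fun q => not_lt.1 (hm q trivial)
  exact (hp.2 m (G.isPath_of_forall_walkLength_le m hm')).trans (hm' q)

/-- A graph with finitely many non-isolated vertices has finitely many shortest paths. -/
theorem shortestPaths_finite_of_support (hG : G.graph.support.Finite) (u v : V) :
    (G.shortestPaths u v).Finite := by
  classical
  set s : Set V := insert u G.graph.support with hs
  have : Fintype s := (hG.insert u).fintype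
  refine Set.Finite.of_injOn (f := fun p => p.support)
    (t := (fun l : List s => l.map Subtype.val) '' {l | l.length ≤ Fintype.card s})
    (fun p hp => ?_) (fun p _ q _ h => SimpleGraph.Walk.ext_support h)
    ((List.finite_length_le s _).image _)
  -- A walk never leaves its start together with the non-isolated vertices, so supports of paths are
  -- repetition-free lists over a finite set.
  have hmem : ∀ {a b : V} (q : G.graph.Walk a b), ∀ x ∈ q.support,
      x ∈ insert a G.graph.support := by
    intro a b q
    induction q with
    | nil => simp
    | @cons a c b e q ih =>
      intro x hx
      rcases List.mem_cons.1 (by simpa using hx) with rfl | hx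
      · exact Set.mem_insert _ _
      · refine Set.mem_insert_of_mem _ ?_
        rcases ih x hx with rfl | h
        · exact ⟨a, e.symm⟩
        · exact h
  have h1 := hmem p
  have h2 := hp.1.support_nodup
  generalize hl : p.support = l at h1 h2
  lift l to List s using h1
  exact ⟨l, (h2.of_map _).length_le_card, hl.symm⟩

theorem numShortestPaths_comm (u v : V) : G.numShortestPaths u v = G.numShortestPaths v u := by
  have key : ∀ a b : V, ∀ p ∈ G.shortestPaths a b, p.reverse ∈ G.shortestPaths b a := by
    intro a b p hp
    rw [mem_shortestPaths_iff] at hp ⊢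
    intro q
    simpa using hp q.reverse
  refine Set.ncard_congr (fun p _ => p.reverse) (key u v)
    (fun p q _ _ h => SimpleGraph.Walk.reverse_injective h)
    fun p hp => ⟨p.reverse, key v u p hp, by simp⟩

theorem numShortestPaths_self (u : V) : G.numShortestPaths u u = 1 := by
  rw [numShortestPaths, Set.ncard_eq_one]
  refine ⟨.nil, Set.ext fun p => ⟨fun hp => ?_, ?_⟩⟩
  · exact (SimpleGraph.Walk.isPath_iff_nil.1 hp.1).eq_nil
  · rintro rfl
    exact G.mem_shortestPaths_iff.2 (by simp)

theorem numShortestPaths_eq_zero {u v : V} (h : IsEmpty (G.graph.Walk u v)) :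
    G.numShortestPaths u v = 0 := by
  rw [numShortestPaths, Set.eq_empty_of_isEmpty (G.shortestPaths u v), Set.ncard_empty]

theorem numShortestPaths_le_one_of_isolated {u v : V} (h : ∀ w, ¬ G.graph.Adj u w) :
    G.numShortestPaths u v ≤ 1 := by
  by_cases huv : u = v
  · subst huv
    exact (G.numShortestPaths_self u).le
  · refine (G.numShortestPaths_eq_zero ⟨fun p => ?_⟩).trans_le zero_le_one
    cases p with
    | nil => exact huv rfl
    | cons e _ => exact h _ e

/-- If every walk from `u` to `v` meets `a` or `b`, then shortest paths can be counted by
splitting them there. -/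
theorem numShortestPaths_le_of_separates (hG : G.graph.support.Finite) {u v a b : V}
    (h : ∀ p : G.graph.Walk u v, a ∈ p.support ∨ b ∈ p.support) :
    G.numShortestPaths u v ≤
      G.numShortestPaths u a * G.numShortestPaths a v +
        G.numShortestPaths u b * G.numShortestPaths b v := by
  classical
  have key : ∀ c : V, {p | p ∈ G.shortestPaths u v ∧ c ∈ p.support} ⊆
      (fun q : G.graph.Walk u c × G.graph.Walk c v => q.1.append q.2) ''
        (G.shortestPaths u c ×ˢ G.shortestPaths c v) := by
    rintro c p ⟨hp, hc⟩
    rw [mem_shortestPaths_iff] at hp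
    have hlen := congrArg G.walkLength (p.take_spec hc)
    rw [walkLength_append] at hlen
    refine ⟨(p.takeUntil c hc, p.dropUntil c hc), ⟨?_, ?_⟩, p.take_spec hc⟩
    · refine G.mem_shortestPaths_iff.2 fun q => ?_
      have := hp (q.append (p.dropUntil c hc))
      rw [walkLength_append] at this
      change G.walkLength (p.takeUntil c hc) ≤ _
      omega
    · refine G.mem_shortestPaths_iff.2 fun q => ?_
      have := hp ((p.takeUntil c hc).append q)
      rw [walkLength_append] at this
      change G.walkLength (p.dropUntil c hc) ≤ _
      omega
  have hfin : ∀ c : V, (G.shortestPaths u c ×ˢ G.shortestPaths c v).Finite := fun c =>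
    (G.shortestPaths_finite_of_support hG u c).prod (G.shortestPaths_finite_of_support hG c v)
  have hcard : ∀ c : V, {p | p ∈ G.shortestPaths u v ∧ c ∈ p.support}.ncard ≤
      G.numShortestPaths u c * G.numShortestPaths c v := fun c =>
    (Set.ncard_le_ncard (key c) ((hfin c).image _)).trans
      ((Set.ncard_image_le (hfin c)).trans_eq Set.ncard_prod)
  have hsub : G.shortestPaths u v ⊆ {p | p ∈ G.shortestPaths u v ∧ a ∈ p.support} ∪
      {p | p ∈ G.shortestPaths u v ∧ b ∈ p.support} := fun p hp =>
    (h p).imp (fun h => ⟨hp, h⟩) fun h => ⟨hp, h⟩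
  have hall := G.shortestPaths_finite_of_support hG u v
  refine (Set.ncard_le_ncard hsub ?_).trans ((Set.ncard_union_le _ _).trans
    (Nat.add_le_add (hcard a) (hcard b)))
  exact (hall.subset fun p hp => hp.1).union (hall.subset fun p hp => hp.1)

/-- If `u` and `v` lie in this order on a shortest walk from `a` to `b`, there are at most as many
shortest paths from `u` to `v` as from `a` to `b`. -/
theorem numShortestPaths_le_of_geodesic (hG : G.graph.support.Finite) {u v a b : V}
    (p₁ : G.graph.Walk a u) (p : G.graph.Walk u v) (p₂ : G.graph.Walk v b)
    (h : ∀ q : G.graph.Walk a b,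
      G.walkLength p₁ + G.walkLength p + G.walkLength p₂ ≤ G.walkLength q) :
    G.numShortestPaths u v ≤ G.numShortestPaths a b := by
  refine Set.ncard_le_ncard_of_injOn (fun q => (p₁.append q).append p₂) (fun q hq => ?_)
    (fun q _ q' _ hqq => ?_) (G.shortestPaths_finite_of_support hG a b)
  · rw [mem_shortestPaths_iff] at hq ⊢
    intro z
    have h1 := hq p
    have h2 := h z
    simp only [walkLength_append]
    omega
  · have h := congrArg SimpleGraph.Walk.support hqq
    simp only [SimpleGraph.Walk.support_append, List.append_left_inj] at h
    apply SimpleGraph.Walk.ext_support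
    rw [List.append_right_inj] at h
    rw [← q.cons_tail_support, ← q'.cons_tail_support, h]

/-! ### Counting shortest paths by means of a distance potential. -/

/-- The edge inequalities telescope along the walk. An explicit potential thus certifies lower
bounds on distances. -/
theorem le_walkLength_of_potential {δ : V → ℕ}
    (hδ : ∀ x y, G.graph.Adj x y → δ x ≤ δ y + G.weight s(x, y)) {u v : V}
    (p : G.graph.Walk v u) : δ v ≤ δ u + G.walkLength p := by
  induction p with
  | nil => simp
  | cons e p ih =>
    have := hδ _ _ e
    rw [walkLength_cons]
    omega

/-- There are exactly `N` walks from `v` to `u` whose length is the prescribed `δ v`. -/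
def HasTightCount (δ : V → ℕ) (u v : V) (N : ℕ) : Prop :=
  {p : G.graph.Walk v u | G.walkLength p = δ v}.encard = N

variable {G} in
-- The potential bounds every walk from below, and `0 < N` says that the bound is attained; so the
-- shortest walks are exactly the tight ones.
theorem HasTightCount.numShortestPaths_eq {δ : V → ℕ} {u v : V} {N : ℕ}
    (h : G.HasTightCount δ u v N) (hu : δ u = 0)
    (hδ : ∀ x y, G.graph.Adj x y → δ x ≤ δ y + G.weight s(x, y)) (hN : 0 < N) :
    G.numShortestPaths u v = N := by
  rw [numShortestPaths_comm]
  have hlow : ∀ q : G.graph.Walk v u, δ v ≤ G.walkLength q := fun q => by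
    simpa [hu] using G.le_walkLength_of_potential hδ q
  have heq : G.shortestPaths v u = {p : G.graph.Walk v u | G.walkLength p = δ v} := by
    ext p
    rw [mem_shortestPaths_iff]
    refine ⟨fun hp => ?_, fun hp q => hp.trans_le (hlow q)⟩
    obtain ⟨q, hq⟩ : {p : G.graph.Walk v u | G.walkLength p = δ v}.Nonempty := by
      rw [← Set.encard_ne_zero, h]
      exact_mod_cast hN.ne'
    exact le_antisymm ((hp q).trans_eq hq) (hlow p)
  rw [numShortestPaths, heq, Set.ncard, h, ENat.toNat_natCast]

theorem hasTightCount_self {δ : V → ℕ} {u : V} (hu : δ u = 0) : G.HasTightCount δ u u 1 := by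
  rw [HasTightCount, Nat.cast_one, Set.encard_eq_one]
  refine ⟨.nil, Set.ext fun p => ?_⟩
  rw [Set.mem_ofPred_eq, hu, Set.mem_singleton_iff]
  refine ⟨fun hp => ?_, by rintro rfl; simp⟩
  cases p with
  | nil => rfl
  | @cons _ w _ e p =>
    have := G.weight_pos s(u, w) e
    rw [walkLength_cons] at hp
    omega

open Classical in
/-- The number of tight walks satisfies the predecessor recursion. -/
theorem hasTightCount_of_forall_mem {δ : V → ℕ} {u v : V} (huv : v ≠ u)
    (hδ : ∀ x y, G.graph.Adj x y → δ x ≤ δ y + G.weight s(x, y)) (hu : δ u = 0) (l : Finset V)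
    (c : V → ℕ)
    (hl : ∀ y, G.graph.Adj v y → δ v = δ y + G.weight s(v, y) → y ∈ l)
    (hc : ∀ y ∈ l, G.graph.Adj v y → δ v = δ y + G.weight s(v, y) → G.HasTightCount δ u y (c y)) :
    G.HasTightCount δ u v
      (∑ y ∈ l, if G.graph.Adj v y ∧ δ v = δ y + G.weight s(v, y) then c y else 0) := by
  set S : V → Set (G.graph.Walk v u) := fun y =>
    {p | δ v = δ y + G.weight s(v, y) ∧ ∃ e : G.graph.Adj v y, ∃ q : G.graph.Walk y u,
      G.walkLength q = δ y ∧ p = .cons e q} with hS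
  have hSc : ∀ y ∈ l, (S y).encard =
      ((if G.graph.Adj v y ∧ δ v = δ y + G.weight s(v, y) then c y else 0 : ℕ) : ℕ∞) := by
    intro y hy
    split_ifs with h
    · rw [← hc y hy h.1 h.2, ← Function.Injective.encard_image
        (f := fun q : G.graph.Walk y u => SimpleGraph.Walk.cons h.1 q) (fun q q' hq => by simpa using hq)]
      congr 1
      ext p
      constructor
      · rintro ⟨-, e, q, hq, rfl⟩
        exact ⟨q, hq, rfl⟩
      · rintro ⟨q, hq, rfl⟩
        exact ⟨h.2, h.1, q, hq, rfl⟩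
    · rw [Nat.cast_zero, Set.encard_eq_zero]
      ext p
      simp only [Set.mem_empty_iff_false, iff_false]
      rintro ⟨h2, e, -⟩
      exact h ⟨e, h2⟩
  have hdisj : ∀ y z p, p ∈ S y → p ∈ S z → y = z := by
    rintro y z p ⟨-, e, q, -, rfl⟩ ⟨-, e', q', -, h⟩
    exact (SimpleGraph.Walk.cons.inj h).1
  -- If the telescoped inequality is an equality, it is one at the first edge and along the rest; so
  -- tight walks split according to a tight first edge.
  have hunion : {p : G.graph.Walk v u | G.walkLength p = δ v} = ⋃ y ∈ l, S y := by
    ext p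
    simp only [Set.mem_ofPred_eq, Set.mem_iUnion, exists_prop]
    constructor
    · intro hp
      cases p with
      | nil => exact absurd rfl huv
      | @cons _ y _ e q =>
        have h1 := hδ _ _ e
        have h2 := G.le_walkLength_of_potential hδ q
        rw [walkLength_cons] at hp
        have h3 : δ v = δ y + G.weight s(v, y) := by omega
        exact ⟨y, hl y e h3, h3, e, q, by omega, rfl⟩
    · rintro ⟨y, -, h, e, q, hq, rfl⟩
      rw [walkLength_cons]
      omega
  have hsum : ∀ l' ⊆ l, (⋃ y ∈ l', S y).encard = ((∑ y ∈ l',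
      if G.graph.Adj v y ∧ δ v = δ y + G.weight s(v, y) then c y else 0 : ℕ) : ℕ∞) := by
    intro l'
    induction l' using Finset.induction_on with
    | empty => simp
    | insert a t ha ih =>
      intro hsub
      rw [Finset.set_biUnion_insert, Set.encard_union_eq, Finset.sum_insert ha, Nat.cast_add,
        ih ((Finset.subset_insert _ _).trans hsub), hSc a (hsub (Finset.mem_insert_self _ _))]
      rw [Set.disjoint_left]
      intro p hp hp'
      simp only [Set.mem_iUnion, exists_prop] at hp'
      obtain ⟨y, hy, hp'⟩ := hp'
      exact ha (hdisj _ _ p hp hp' ▸ hy)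
  rw [HasTightCount, hunion, hsum l subset_rfl]

/-- A vertex with a single tight predecessor inherits its count. -/
theorem hasTightCount_of_unique {δ : V → ℕ} {u v y : V} {N : ℕ} (huv : v ≠ u)
    (hδ : ∀ x y, G.graph.Adj x y → δ x ≤ δ y + G.weight s(x, y)) (hu : δ u = 0)
    (hvy : G.graph.Adj v y) (ht : δ v = δ y + G.weight s(v, y))
    (hl : ∀ z, G.graph.Adj v z → δ v = δ z + G.weight s(v, z) → z = y)
    (hy : G.HasTightCount δ u y N) : G.HasTightCount δ u v N := by
  classical
  have := G.hasTightCount_of_forall_mem huv hδ hu {y} (fun _ => N)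
    (fun z h1 h2 => Finset.mem_singleton.2 (hl z h1 h2))
    (fun z hz _ _ => by rwa [Finset.mem_singleton.1 hz])
  simpa [hvy, ht] using this

end WeightedGraph

/-! ### The gadget grid and its weights. -/

namespace GadgetGrid

/-- Distance of two natural numbers, in a form convenient for linear arithmetic. -/
def natDist (a b : ℕ) : ℕ := (a - b) + (b - a)

theorem natDist_comm (a b : ℕ) : natDist a b = natDist b a := Nat.add_comm _ _

/-- The weight of the vertical edges of the grid. -/
def vertWeight (k r : ℕ) : ℕ := k + 2 * r + 2

/-- The links of the gadget grid. The grid vertices are `(i, j, 0)`, where `i` is the row and `j`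
the column. The cell with upper left corner `(i, j, 0)` and lower right corner `(i + 1, j + 1, 0)`
contains the gadget vertices `(i + 1, j + 1, a)`, `1 ≤ a ≤ 2 * r`. Links are horizontal and vertical
grid edges, edges from the upper left corner into the gadget (one for each binary digit one
of `x i j`), and edges decreasing `a` by one or two within the gadget. -/
def Link (k r : ℕ) (x : ℕ → ℕ → ℕ) : ℕ × ℕ × ℕ → ℕ × ℕ × ℕ → Prop
  | (i, j, a), (i', j', a') =>
    (i' = i ∧ j' = j + 1 ∧ a = 0 ∧ a' = 0 ∧ i ≤ k ∧ j + 1 ≤ k) ∨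
    (i' = i + 1 ∧ j' = j ∧ a = 0 ∧ a' = 0 ∧ i + 1 ≤ k ∧ j ≤ k) ∨
    (i' = i + 1 ∧ j' = j + 1 ∧ a = 0 ∧ a' % 2 = 0 ∧ a' ≤ 2 * r ∧ i + 1 ≤ k ∧ j + 1 ≤ k ∧
      x i j / 2 ^ (a' / 2) % 2 = 1) ∨
    (i' = i ∧ j' = j ∧ 1 ≤ i ∧ 1 ≤ j ∧ i ≤ k ∧ j ≤ k ∧ a = a' + 1 ∧ a ≤ 2 * r) ∨
    (i' = i ∧ j' = j ∧ 1 ≤ i ∧ 1 ≤ j ∧ i ≤ k ∧ j ≤ k ∧ a = a' + 2 ∧ a' % 2 = 0 ∧ a ≤ 2 * r)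

/-- The weight of a link, as a symmetric function of its two ends. -/
def linkWeight (k r : ℕ) : ℕ × ℕ × ℕ → ℕ × ℕ × ℕ → ℕ
  | (i, j, a), (i', j', a') =>
    if i = i' ∧ j = j' then natDist a a'
    -- On links this gives `i + 1` along rows, `V` along columns, and `V + i + 1 - a'` from a corner
    -- into the gadget. The last one leaves exactly the length `a'` of the chain below, so all
    -- routes through a gadget have equal length.
    else vertWeight k r * natDist i i' + (min i i' + 1) * natDist j j' - (a + a')

theorem linkWeight_comm (k r : ℕ) (u v : ℕ × ℕ × ℕ) : linkWeight k r u v = linkWeight k r v u := by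
  obtain ⟨i, j, a⟩ := u
  obtain ⟨i', j', a'⟩ := v
  simp only [linkWeight, natDist_comm i, natDist_comm j, natDist_comm a, min_comm i,
    Nat.add_comm a, eq_comm (a := i), eq_comm (a := j)]

/-- The links come with their weights. -/
theorem Link.cases_weight {k r : ℕ} {x : ℕ → ℕ → ℕ} {i j a i' j' a' : ℕ}
    (h : Link k r x (i, j, a) (i', j', a')) :
    (i' = i ∧ j' = j + 1 ∧ a = 0 ∧ a' = 0 ∧ i ≤ k ∧ j + 1 ≤ k ∧
      linkWeight k r (i, j, a) (i', j', a') = i + 1) ∨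
    (i' = i + 1 ∧ j' = j ∧ a = 0 ∧ a' = 0 ∧ i + 1 ≤ k ∧ j ≤ k ∧
      linkWeight k r (i, j, a) (i', j', a') = vertWeight k r) ∨
    (i' = i + 1 ∧ j' = j + 1 ∧ a = 0 ∧ a' % 2 = 0 ∧ a' ≤ 2 * r ∧ i + 1 ≤ k ∧ j + 1 ≤ k ∧
      x i j / 2 ^ (a' / 2) % 2 = 1 ∧
      linkWeight k r (i, j, a) (i', j', a') = vertWeight k r + i + 1 - a') ∨
    (i' = i ∧ j' = j ∧ 1 ≤ i ∧ 1 ≤ j ∧ i ≤ k ∧ j ≤ k ∧ a = a' + 1 ∧ a ≤ 2 * r ∧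
      linkWeight k r (i, j, a) (i', j', a') = 1) ∨
    (i' = i ∧ j' = j ∧ 1 ≤ i ∧ 1 ≤ j ∧ i ≤ k ∧ j ≤ k ∧ a = a' + 2 ∧ a' % 2 = 0 ∧ a ≤ 2 * r ∧
      linkWeight k r (i, j, a) (i', j', a') = 2) := by
  rcases h with ⟨rfl, rfl, rfl, rfl, h1, h2⟩ | ⟨rfl, rfl, rfl, rfl, h1, h2⟩ |
    ⟨rfl, rfl, rfl, h1, h2, h3, h4, h5⟩ | ⟨rfl, rfl, h1, h2, h3, h4, rfl, h6⟩ |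
    ⟨rfl, rfl, h1, h2, h3, h4, rfl, h6, h7⟩
  · exact .inl ⟨rfl, rfl, rfl, rfl, h1, h2, by simp [linkWeight, natDist]⟩
  · exact .inr <| .inl ⟨rfl, rfl, rfl, rfl, h1, h2, by simp [linkWeight, natDist]⟩
  · exact .inr <| .inr <| .inl ⟨rfl, rfl, rfl, h1, h2, h3, h4, h5, by
      simp [linkWeight, natDist, Nat.add_assoc]⟩
  · exact .inr <| .inr <| .inr <| .inl ⟨rfl, rfl, h1, h2, h3, h4, rfl, h6, by
      simp only [linkWeight, natDist, and_self, if_true]; omega⟩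
  · exact .inr <| .inr <| .inr <| .inr ⟨rfl, rfl, h1, h2, h3, h4, rfl, h6, h7, by
      simp only [linkWeight, natDist, and_self, if_true]; omega⟩

theorem Link.linkWeight_pos {k r : ℕ} {x : ℕ → ℕ → ℕ} {u v : ℕ × ℕ × ℕ} (h : Link k r x u v) :
    0 < linkWeight k r u v := by
  obtain ⟨i, j, a⟩ := u
  obtain ⟨i', j', a'⟩ := v
  have := h.cases_weight
  simp only [vertWeight] at this
  omega

theorem not_link_self {k r : ℕ} {x : ℕ → ℕ → ℕ} (u : ℕ × ℕ × ℕ) : ¬ Link k r x u u := by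
  obtain ⟨i, j, a⟩ := u
  intro h
  have := h.cases_weight
  omega

/-- The gadget grid with `k + 1` rows and columns, in which the gadget of the cell `(i, j)` encodes
the number `x i j < 2 ^ (r + 1)`. -/
def grid (k r : ℕ) (x : ℕ → ℕ → ℕ) : WeightedGraph (ℕ × ℕ × ℕ) where
  graph :=
    { Adj := fun u v => Link k r x u v ∨ Link k r x v u
      symm := ⟨fun _ _ h => h.symm⟩
      loopless := ⟨fun u h => not_link_self u (or_self_iff.1 h)⟩ }
  weight := Sym2.lift ⟨linkWeight k r, linkWeight_comm k r⟩
  weight_pos := by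
    refine Sym2.ind fun u v h => ?_
    rcases h with h | h
    · exact h.linkWeight_pos
    · rw [Sym2.lift_mk]
      exact h.linkWeight_pos.trans_eq (linkWeight_comm k r v u)

@[simp] theorem grid_weight (k r : ℕ) (x : ℕ → ℕ → ℕ) (u v : ℕ × ℕ × ℕ) :
    (grid k r x).weight s(u, v) = linkWeight k r u v := rfl

/-! ### Distances in the gadget grid. -/

/-- Distance in the plain grid from `(i₀, j₀)` to `(i, j)`. -/
def gridDist (k r i₀ j₀ i j : ℕ) : ℕ :=
  vertWeight k r * natDist i i₀ + (min i i₀ + 1) * natDist j j₀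

theorem gridDist_self (k r i₀ j₀ : ℕ) : gridDist k r i₀ j₀ i₀ j₀ = 0 := by
  simp [gridDist, natDist]

theorem gridDist_right (k r i₀ j₀ i j : ℕ) :
    (j₀ ≤ j ∧ gridDist k r i₀ j₀ i (j + 1) = gridDist k r i₀ j₀ i j + (min i i₀ + 1)) ∨
    (j < j₀ ∧ gridDist k r i₀ j₀ i j = gridDist k r i₀ j₀ i (j + 1) + (min i i₀ + 1)) := by
  rcases le_or_gt j₀ j with h | h
  · refine .inl ⟨h, ?_⟩
    have : natDist (j + 1) j₀ = natDist j j₀ + 1 := by simp only [natDist]; omega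
    rw [gridDist, gridDist, this]
    ring
  · refine .inr ⟨h, ?_⟩
    have : natDist j j₀ = natDist (j + 1) j₀ + 1 := by simp only [natDist]; omega
    rw [gridDist, gridDist, this]
    ring

/-- Below the source a vertical step costs just its weight. Above the source the row of `(i, j)`
fixes the horizontal price, so one row further down each column costs one more: this is the term
`natDist j j₀`. -/
theorem gridDist_down (k r i₀ j₀ i j : ℕ) :
    (i₀ ≤ i ∧ gridDist k r i₀ j₀ (i + 1) j = gridDist k r i₀ j₀ i j + vertWeight k r) ∨
    (i < i₀ ∧ gridDist k r i₀ j₀ i j + natDist j j₀ =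
      gridDist k r i₀ j₀ (i + 1) j + vertWeight k r) := by
  rcases le_or_gt i₀ i with h | h
  · refine .inl ⟨h, ?_⟩
    have : natDist (i + 1) i₀ = natDist i i₀ + 1 := by simp only [natDist]; omega
    rw [gridDist, gridDist, this, min_eq_right h, min_eq_right (h.trans i.le_succ)]
    ring
  · refine .inr ⟨h, ?_⟩
    have : natDist i i₀ = natDist (i + 1) i₀ + 1 := by simp only [natDist]; omega
    rw [gridDist, gridDist, this, min_eq_left h.le, min_eq_left (show i + 1 ≤ i₀ from h)]
    ring

/-- Distance from the grid vertex `(i₀, j₀)` to an arbitrary vertex. -/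
def dist (k r i₀ j₀ : ℕ) : ℕ × ℕ × ℕ → ℕ
  -- A gadget vertex is approached up the chain from the lower right corner, or from the upper left
  -- corner. The second term ignores whether the needed digit is set; only lower bounds are required
  -- of the potential.
  | (i, j, a) => min (gridDist k r i₀ j₀ i j + a)
      (gridDist k r i₀ j₀ (i - 1) (j - 1) + vertWeight k r + i - a)

section

variable {k r i₀ j₀ : ℕ} {x : ℕ → ℕ → ℕ}

/-- Crossing a gadget is never shorter than following grid edges, since a vertical edge outweighs
the at most `k` units that a change of row can save horizontally. -/
theorem dist_zero {i j : ℕ} (hj₀ : j₀ ≤ k) (hj : j ≤ k) :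
    dist k r i₀ j₀ (i, j, 0) = gridDist k r i₀ j₀ i j := by
  have hz : natDist j j₀ ≤ k := by simp only [natDist]; omega
  have hz' : natDist (j - 1) j₀ ≤ k := by simp only [natDist]; omega
  simp only [dist]
  rcases i with _ | i <;> rcases j with _ | j
  · simp
  · have := gridDist_right k r i₀ j₀ 0 j
    have hV : 1 ≤ vertWeight k r := by simp only [vertWeight]; omega
    simp only [Nat.add_sub_cancel, Nat.zero_sub]
    omega
  · have := gridDist_down k r i₀ j₀ i 0
    have hV : k ≤ vertWeight k r := by simp only [vertWeight]; omega
    simp only [Nat.add_sub_cancel, Nat.zero_sub]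
    omega
  · have h1 := gridDist_down k r i₀ j₀ i (j + 1)
    have h2 := gridDist_right k r i₀ j₀ i j
    have hV : k ≤ vertWeight k r := by simp only [vertWeight]; omega
    simp only [Nat.add_sub_cancel] at hz' ⊢
    omega

theorem dist_succ (i j a : ℕ) : dist k r i₀ j₀ (i + 1, j + 1, a) =
    min (gridDist k r i₀ j₀ (i + 1) (j + 1) + a)
      (gridDist k r i₀ j₀ i j + vertWeight k r + (i + 1) - a) := rfl

/-- Makes `dist` a feasible potential, with both orientations of each edge checked. -/
theorem dist_le_of_link (hj₀ : j₀ ≤ k) {u v : ℕ × ℕ × ℕ} (h : Link k r x u v) :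
    dist k r i₀ j₀ u ≤ dist k r i₀ j₀ v + linkWeight k r u v ∧
      dist k r i₀ j₀ v ≤ dist k r i₀ j₀ u + linkWeight k r u v := by
  obtain ⟨i, j, a⟩ := u
  obtain ⟨i', j', a'⟩ := v
  have hV : vertWeight k r = k + 2 * r + 2 := rfl
  rcases h.cases_weight with ⟨rfl, rfl, rfl, rfl, h1, h2, hw⟩ | ⟨rfl, rfl, rfl, rfl, h1, h2, hw⟩ |
    ⟨rfl, rfl, rfl, h1, h2, h3, h4, h5, hw⟩ | ⟨rfl, rfl, h1, h2, h3, h4, rfl, h6, hw⟩ |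
    ⟨rfl, rfl, h1, h2, h3, h4, rfl, h6, h7, hw⟩
  · rw [hw, dist_zero hj₀ h2, dist_zero hj₀ (by omega)]
    have := gridDist_right k r i₀ j₀ i' j
    omega
  · rw [hw, dist_zero hj₀ h2, dist_zero hj₀ (by omega)]
    have := gridDist_down k r i₀ j₀ i j'
    have hz : natDist j' j₀ ≤ k := by simp only [natDist]; omega
    omega
  · rw [hw, dist_zero hj₀ (by omega), dist_succ]
    have := gridDist_down k r i₀ j₀ i (j + 1)
    have := gridDist_right k r i₀ j₀ i j
    have hz : natDist (j + 1) j₀ ≤ k := by simp only [natDist]; omega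
    omega
  · rw [hw]
    simp only [dist]
    omega
  · rw [hw]
    simp only [dist]
    omega

theorem dist_le_of_adj (hj₀ : j₀ ≤ k) (u v : ℕ × ℕ × ℕ) (h : (grid k r x).graph.Adj u v) :
    dist k r i₀ j₀ u ≤ dist k r i₀ j₀ v + (grid k r x).weight s(u, v) := by
  rw [grid_weight]
  rcases h with h | h
  · exact (dist_le_of_link hj₀ h).1
  · rw [linkWeight_comm]
    exact (dist_le_of_link hj₀ h).2

theorem dist_self (hj₀ : j₀ ≤ k) : dist k r i₀ j₀ (i₀, j₀, 0) = 0 := by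
  rw [dist_zero hj₀ hj₀, gridDist_self]

end

/-! ### Tight edges and the number of tight walks. -/

open WeightedGraph

section

variable {k r i₀ j₀ : ℕ} {x : ℕ → ℕ → ℕ}

/-- The possible neighbours of a vertex, with the weights of the edges leading to them. -/
theorem adj_cases {i j a i' j' a' : ℕ} (h : (grid k r x).graph.Adj (i, j, a) (i', j', a')) :
    ∃ w, (grid k r x).weight s((i, j, a), (i', j', a')) = w ∧
    ((i' = i ∧ j' = j + 1 ∧ a = 0 ∧ a' = 0 ∧ i ≤ k ∧ j + 1 ≤ k ∧ w = i + 1) ∨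
    (i' = i + 1 ∧ j' = j ∧ a = 0 ∧ a' = 0 ∧ i + 1 ≤ k ∧ j ≤ k ∧ w = vertWeight k r) ∨
    (i' = i + 1 ∧ j' = j + 1 ∧ a = 0 ∧ a' % 2 = 0 ∧ a' ≤ 2 * r ∧ i + 1 ≤ k ∧ j + 1 ≤ k ∧
      w = vertWeight k r + i + 1 - a') ∨
    (i' = i ∧ j' = j ∧ 1 ≤ i ∧ 1 ≤ j ∧ i ≤ k ∧ j ≤ k ∧ a = a' + 1 ∧ a ≤ 2 * r ∧ w = 1) ∨
    (i' = i ∧ j' = j ∧ 1 ≤ i ∧ 1 ≤ j ∧ i ≤ k ∧ j ≤ k ∧ a = a' + 2 ∧ a' % 2 = 0 ∧ a ≤ 2 * r ∧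
      w = 2) ∨
    (i = i' ∧ j = j' + 1 ∧ a' = 0 ∧ a = 0 ∧ i' ≤ k ∧ j' + 1 ≤ k ∧ w = i' + 1) ∨
    (i = i' + 1 ∧ j = j' ∧ a' = 0 ∧ a = 0 ∧ i' + 1 ≤ k ∧ j' ≤ k ∧ w = vertWeight k r) ∨
    (i = i' + 1 ∧ j = j' + 1 ∧ a' = 0 ∧ a % 2 = 0 ∧ a ≤ 2 * r ∧ i' + 1 ≤ k ∧ j' + 1 ≤ k ∧
      x i' j' / 2 ^ (a / 2) % 2 = 1 ∧ w = vertWeight k r + i' + 1 - a) ∨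
    (i = i' ∧ j = j' ∧ 1 ≤ i' ∧ 1 ≤ j' ∧ i' ≤ k ∧ j' ≤ k ∧ a' = a + 1 ∧ a' ≤ 2 * r ∧ w = 1) ∨
    (i = i' ∧ j = j' ∧ 1 ≤ i' ∧ 1 ≤ j' ∧ i' ≤ k ∧ j' ≤ k ∧ a' = a + 2 ∧ a % 2 = 0 ∧ a' ≤ 2 * r ∧
      w = 2)) := by
  refine ⟨_, rfl, ?_⟩
  rw [grid_weight]
  rcases h with h | h
  · rcases h.cases_weight with h | h | ⟨h1, h2, h3, h4, h5, h6, h7, -, h8⟩ | h | h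
    · exact .inl h
    · exact .inr <| .inl h
    · exact .inr <| .inr <| .inl ⟨h1, h2, h3, h4, h5, h6, h7, h8⟩
    · exact .inr <| .inr <| .inr <| .inl h
    · exact .inr <| .inr <| .inr <| .inr <| .inl h
  · rw [linkWeight_comm]
    refine .inr <| .inr <| .inr <| .inr <| .inr ?_
    exact h.cases_weight

/-- Adjacency along the rows. -/
theorem adj_right {i j : ℕ} (hi : i ≤ k) (hj : j + 1 ≤ k) :
    (grid k r x).graph.Adj (i, j, 0) (i, j + 1, 0) ∧
      (grid k r x).weight s((i, j, 0), (i, j + 1, 0)) = i + 1 := by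
  have h : Link k r x (i, j, 0) (i, j + 1, 0) := .inl ⟨rfl, rfl, rfl, rfl, hi, hj⟩
  refine ⟨.inl h, ?_⟩
  rw [grid_weight]
  have := h.cases_weight
  omega

theorem adj_down {i j : ℕ} (hi : i + 1 ≤ k) (hj : j ≤ k) :
    (grid k r x).graph.Adj (i, j, 0) (i + 1, j, 0) ∧
      (grid k r x).weight s((i, j, 0), (i + 1, j, 0)) = vertWeight k r := by
  have h : Link k r x (i, j, 0) (i + 1, j, 0) := .inr <| .inl ⟨rfl, rfl, rfl, rfl, hi, hj⟩
  refine ⟨.inl h, ?_⟩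
  rw [grid_weight]
  have := h.cases_weight
  omega

theorem adj_fan {i j a : ℕ} (hi : i + 1 ≤ k) (hj : j + 1 ≤ k) (ha : a % 2 = 0) (har : a ≤ 2 * r)
    (hx : x i j / 2 ^ (a / 2) % 2 = 1) :
    (grid k r x).graph.Adj (i, j, 0) (i + 1, j + 1, a) ∧
      (grid k r x).weight s((i, j, 0), (i + 1, j + 1, a)) = vertWeight k r + i + 1 - a := by
  have h : Link k r x (i, j, 0) (i + 1, j + 1, a) :=
    .inr <| .inr <| .inl ⟨rfl, rfl, rfl, ha, har, hi, hj, hx⟩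
  refine ⟨.inl h, ?_⟩
  rw [grid_weight]
  have := h.cases_weight
  omega

theorem adj_step {i j a : ℕ} (hi : i + 1 ≤ k) (hj : j + 1 ≤ k) (har : a + 1 ≤ 2 * r) :
    (grid k r x).graph.Adj (i + 1, j + 1, a + 1) (i + 1, j + 1, a) ∧
      (grid k r x).weight s((i + 1, j + 1, a + 1), (i + 1, j + 1, a)) = 1 := by
  have h : Link k r x (i + 1, j + 1, a + 1) (i + 1, j + 1, a) :=
    .inr <| .inr <| .inr <| .inl ⟨rfl, rfl, by omega, by omega, hi, hj, rfl, har⟩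
  refine ⟨.inl h, ?_⟩
  rw [grid_weight]
  have := h.cases_weight
  omega

theorem adj_skip {i j a : ℕ} (hi : i + 1 ≤ k) (hj : j + 1 ≤ k) (ha : a % 2 = 0)
    (har : a + 2 ≤ 2 * r) :
    (grid k r x).graph.Adj (i + 1, j + 1, a + 2) (i + 1, j + 1, a) ∧
      (grid k r x).weight s((i + 1, j + 1, a + 2), (i + 1, j + 1, a)) = 2 := by
  have h : Link k r x (i + 1, j + 1, a + 2) (i + 1, j + 1, a) :=
    .inr <| .inr <| .inr <| .inr ⟨rfl, rfl, by omega, by omega, hi, hj, rfl, ha, har⟩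
  refine ⟨.inl h, ?_⟩
  rw [grid_weight]
  have := h.cases_weight
  omega

/-- A tight edge from the upper left corner into a gadget starts in the row of the source. -/
theorem eq_row_of_gadget_tight {i j a : ℕ} (hj₀ : j₀ ≤ k) (hj : j + 1 ≤ k) (hi : i₀ ≤ i + 1)
    (ha : a = 0 ∨ i = i₀ ∧ j₀ ≤ j)
    (h : gridDist k r i₀ j₀ i j + vertWeight k r + (i + 1) ≤
      gridDist k r i₀ j₀ (i + 1) (j + 1) + 2 * a) : i = i₀ ∧ j₀ ≤ j := by
  rcases ha with rfl | ha
  · have hV : k < vertWeight k r := by rw [vertWeight]; omega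
    have hz : natDist (j + 1) j₀ ≤ k := by simp only [natDist]; omega
    rcases gridDist_right k r i₀ j₀ i j with h1 | h1 <;>
      rcases gridDist_down k r i₀ j₀ i (j + 1) with h2 | h2 <;> omega
  · exact ha

set_option maxHeartbeats 1600000 in
/-- The tight predecessors of a vertex on or below the row of the source. -/
theorem tight_cases {i j a : ℕ} (hj₀ : j₀ ≤ k) (hi : i₀ ≤ i)
    (ha : a = 0 ∨ a ≤ 2 * r ∧ i = i₀ + 1 ∧ j₀ < j) {y : ℕ × ℕ × ℕ}
    (hy : (grid k r x).graph.Adj (i, j, a) y)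
    (ht : dist k r i₀ j₀ (i, j, a) =
      dist k r i₀ j₀ y + (grid k r x).weight s((i, j, a), y)) :
    (i = i₀ ∧ j₀ < j ∧ a = 0 ∧ y = (i, j - 1, 0)) ∨
    (i = i₀ ∧ j < j₀ ∧ a = 0 ∧ y = (i, j + 1, 0)) ∨
    (i₀ < i ∧ a = 0 ∧ y = (i - 1, j, 0)) ∨
    (i = i₀ + 1 ∧ j₀ < j ∧ (y = (i₀, j - 1, 0) ∨ y = (i, j, a + 1) ∨ y = (i, j, a + 2))) := by
  obtain ⟨i', j', a'⟩ := y
  have hV : vertWeight k r = k + 2 * r + 2 := rfl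
  obtain ⟨w, hw, hz⟩ := adj_cases hy
  rw [hw] at ht
  rcases hz with ⟨rfl, rfl, rfl, rfl, h1, h2, rfl⟩ | ⟨rfl, rfl, rfl, rfl, h1, h2, rfl⟩ |
    ⟨rfl, rfl, rfl, h1, h2, h3, h4, rfl⟩ | ⟨rfl, rfl, h1, h2, h3, h4, rfl, h5, rfl⟩ |
    ⟨rfl, rfl, h1, h2, h3, h4, rfl, h5, h6, rfl⟩ | ⟨rfl, rfl, rfl, rfl, h3, h4, rfl⟩ |
    ⟨rfl, rfl, rfl, rfl, h1, h2, rfl⟩ | ⟨rfl, rfl, rfl, h2, h3, h4, h5, -, rfl⟩ |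
    ⟨rfl, rfl, h1, h2, h3, h4, rfl, h5, rfl⟩ | ⟨rfl, rfl, h1, h2, h3, h4, rfl, h5, h6, rfl⟩
  · rw [dist_zero hj₀ h2, dist_zero hj₀ (by omega)] at ht
    have := gridDist_right k r i₀ j₀ i' j
    refine .inr <| .inl ⟨by omega, by omega, rfl, rfl⟩
  · rw [dist_zero hj₀ h2, dist_zero hj₀ h2] at ht
    have := gridDist_down k r i₀ j₀ i j'
    omega
  · rw [dist_zero hj₀ (by omega), dist_succ] at ht
    clear ha
    rcases gridDist_right k r i₀ j₀ i j with h7 | h7 <;>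
      rcases gridDist_down k r i₀ j₀ i (j + 1) with h8 | h8 <;> omega
  · obtain ⟨i, rfl⟩ : ∃ n, i' = n + 1 := ⟨i' - 1, by omega⟩
    obtain ⟨j, rfl⟩ : ∃ n, j' = n + 1 := ⟨j' - 1, by omega⟩
    rw [dist_succ, dist_succ] at ht
    rcases ha with ha | ⟨-, ha, ha'⟩
    · omega
    · rcases gridDist_right k r i₀ j₀ i j with h7 | h7 <;>
        rcases gridDist_down k r i₀ j₀ i (j + 1) with h8 | h8 <;> omega
  · obtain ⟨i, rfl⟩ : ∃ n, i' = n + 1 := ⟨i' - 1, by omega⟩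
    obtain ⟨j, rfl⟩ : ∃ n, j' = n + 1 := ⟨j' - 1, by omega⟩
    rw [dist_succ, dist_succ] at ht
    rcases ha with ha | ⟨-, ha, ha'⟩
    · omega
    · rcases gridDist_right k r i₀ j₀ i j with h7 | h7 <;>
        rcases gridDist_down k r i₀ j₀ i (j + 1) with h8 | h8 <;> omega
  · rw [dist_zero hj₀ h4, dist_zero hj₀ (by omega)] at ht
    have := gridDist_right k r i₀ j₀ i j'
    refine .inl ⟨by omega, by omega, rfl, by simp⟩
  · rw [dist_zero hj₀ h2, dist_zero hj₀ h2] at ht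
    have := gridDist_down k r i₀ j₀ i' j
    have hz : natDist j j₀ ≤ k := by simp only [natDist]; omega
    refine .inr <| .inr <| .inl ⟨by omega, rfl, by simp⟩
  · rw [dist_zero hj₀ (by omega), dist_succ] at ht
    obtain ⟨h6, h7⟩ := eq_row_of_gadget_tight (r := r) (a := a) hj₀ h5 hi (by omega) (by omega)
    subst h6
    exact .inr <| .inr <| .inr ⟨rfl, by omega, .inl (by simp)⟩
  · obtain ⟨i', rfl⟩ : ∃ n, i = n + 1 := ⟨i - 1, by omega⟩
    obtain ⟨j', rfl⟩ : ∃ n, j = n + 1 := ⟨j - 1, by omega⟩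
    rw [dist_succ, dist_succ] at ht
    obtain ⟨h6, h7⟩ := eq_row_of_gadget_tight (r := r) (a := a) hj₀ h4 hi (by omega) (by omega)
    exact .inr <| .inr <| .inr ⟨by omega, by omega, .inr (.inl rfl)⟩
  · obtain ⟨i', rfl⟩ : ∃ n, i = n + 1 := ⟨i - 1, by omega⟩
    obtain ⟨j', rfl⟩ : ∃ n, j = n + 1 := ⟨j - 1, by omega⟩
    rw [dist_succ, dist_succ] at ht
    obtain ⟨h6, h7⟩ := eq_row_of_gadget_tight (r := r) (a := a) hj₀ h4 hi (by omega) (by omega)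
    exact .inr <| .inr <| .inr ⟨by omega, by omega, .inr (.inr rfl)⟩

variable (k r i₀ j₀ x) in
/-- The number of tight walks from `(i₀, j₀, 0)` to `v`. -/
abbrev Count (v : ℕ × ℕ × ℕ) (N : ℕ) : Prop :=
  (grid k r x).HasTightCount (dist k r i₀ j₀) (i₀, j₀, 0) v N

/-- Within the row of the source, the only tight predecessor is the horizontal neighbour towards the
source. -/
theorem count_row (hi₀ : i₀ ≤ k) (hj₀ : j₀ ≤ k) {j : ℕ} (hj : j ≤ k) :
    Count k r i₀ j₀ x (i₀, j, 0) 1 := by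
  rcases le_total j₀ j with h | h
  · induction j, h using Nat.le_induction with
    | base => exact hasTightCount_self _ (dist_self hj₀)
    | succ j h ih =>
      obtain ⟨hadj, hw⟩ := adj_right (r := r) (x := x) hi₀ hj
      refine hasTightCount_of_unique _ (by simp; omega) (dist_le_of_adj hj₀) (dist_self hj₀)
        hadj.symm ?_ (fun z hz ht => ?_) (ih (by omega))
      · rw [Sym2.eq_swap, hw, dist_zero hj₀ hj, dist_zero hj₀ (by omega)]
        have := gridDist_right k r i₀ j₀ i₀ j
        omega
      · have := tight_cases hj₀ le_rfl (.inl rfl) hz ht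
        rw [Nat.add_sub_cancel] at this
        rcases this with h | h | h | h
        · exact h.2.2.2
        all_goals omega
  · induction h using Nat.decreasingInduction with
    | self => exact hasTightCount_self _ (dist_self hj₀)
    | of_succ j h ih =>
      obtain ⟨hadj, hw⟩ := adj_right (r := r) (x := x) hi₀ (show j + 1 ≤ k by omega)
      refine hasTightCount_of_unique _ (by simp; omega) (dist_le_of_adj hj₀) (dist_self hj₀)
        hadj ?_ (fun z hz ht => ?_) (ih (by omega))
      · rw [hw, dist_zero hj₀ hj, dist_zero hj₀ (by omega)]
        have := gridDist_right k r i₀ j₀ i₀ j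
        omega
      · rcases tight_cases hj₀ le_rfl (.inl rfl) hz ht with h | h | h | h
        · omega
        · exact h.2.2.2
        all_goals omega

/-- `hij` excludes the one place where a gadget contributes: entering row `i₀ + 1` to the right of
the source. Elsewhere the vertex above is the only tight predecessor. -/
theorem count_down (hj₀ : j₀ ≤ k) {i j N : ℕ} (hi : i₀ ≤ i) (hik : i + 1 ≤ k) (hj : j ≤ k)
    (hij : i₀ < i ∨ j ≤ j₀) (h : Count k r i₀ j₀ x (i, j, 0) N) :
    Count k r i₀ j₀ x (i + 1, j, 0) N := by
  obtain ⟨hadj, hw⟩ := adj_down (r := r) (x := x) hik hj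
  refine hasTightCount_of_unique _ (by simp; omega) (dist_le_of_adj hj₀) (dist_self hj₀)
    hadj.symm ?_ (fun z hz ht => ?_) h
  · rw [Sym2.eq_swap, hw, dist_zero hj₀ hj, dist_zero hj₀ (by omega)]
    have := gridDist_down k r i₀ j₀ i j
    omega
  · rcases tight_cases hj₀ (by omega) (.inl rfl) hz ht with h | h | h | h
    · omega
    · omega
    · exact h.2.2
    · omega

/-- The gadget of a cell in the row of the source. -/
theorem count_gadget (hj₀ : j₀ ≤ k) {j a : ℕ} (hi : i₀ + 1 ≤ k) (hj : j₀ ≤ j) (hjk : j + 1 ≤ k)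
    (ha : a ≤ 2 * r) (hx : x i₀ j < 2 ^ (r + 1)) :
    Count k r i₀ j₀ x (i₀ + 1, j + 1, a)
      (x i₀ j / 2 ^ ((a + 1) / 2) + if a = 0 then 1 else 0) := by
  classical
  have hR := gridDist_right k r i₀ j₀ i₀ j
  have hD := gridDist_down k r i₀ j₀ i₀ (j + 1)
  have hV : vertWeight k r = k + 2 * r + 2 := rfl
  have hdist : ∀ b ≤ 2 * r, dist k r i₀ j₀ (i₀ + 1, j + 1, b) =
      gridDist k r i₀ j₀ i₀ j + vertWeight k r + (i₀ + 1) - b := by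
    intro b hb
    rw [dist_succ]
    omega
  -- Among the candidate predecessors listed next, last coordinate `0` occurs only in the source
  -- row, where the count is `1`.
  set c : ℕ × ℕ × ℕ → ℕ := fun y => if y.2.2 = 0 then 1 else x i₀ j / 2 ^ ((y.2.2 + 1) / 2) with hc
  have key := (grid k r x).hasTightCount_of_forall_mem (v := (i₀ + 1, j + 1, a))
    (u := (i₀, j₀, 0)) (by simp) (dist_le_of_adj hj₀) (dist_self hj₀)
    {(i₀, j + 1, 0), (i₀ + 1, j + 1, a + 1), (i₀ + 1, j + 1, a + 2), (i₀, j, 0)} c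
    (fun y hy ht => by
      rcases tight_cases hj₀ (by omega) (.inr ⟨ha, rfl, by omega⟩) hy ht with
        h | h | h | ⟨-, -, h | h | h⟩
      · omega
      · omega
      · simp [h.2.2]
      · simp [h]
      · simp [h]
      · simp [h])
    (fun y hy h1 h2 => by
      simp only [Finset.mem_insert, Finset.mem_singleton] at hy
      rcases hy with rfl | rfl | rfl | rfl
      · exact count_row (by omega) hj₀ hjk
      · obtain ⟨w, -, h⟩ := adj_cases h1
        have := count_gadget hj₀ hi hj hjk (show a + 1 ≤ 2 * r by omega) hx
        simpa [hc] using this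
      · obtain ⟨w, -, h⟩ := adj_cases h1
        have := count_gadget hj₀ hi hj hjk (show a + 2 ≤ 2 * r by omega) hx
        simpa [hc] using this
      · exact count_row (by omega) hj₀ (by omega))
  rw [Finset.sum_insert (by simp), Finset.sum_insert (by simp), Finset.sum_insert (by simp),
    Finset.sum_singleton] at key
  have hup : ((grid k r x).graph.Adj (i₀ + 1, j + 1, a) (i₀, j + 1, 0) ∧
      dist k r i₀ j₀ (i₀ + 1, j + 1, a) = dist k r i₀ j₀ (i₀, j + 1, 0) +
        (grid k r x).weight s((i₀ + 1, j + 1, a), (i₀, j + 1, 0))) ↔ a = 0 := by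
    constructor
    · rintro ⟨h, -⟩
      obtain ⟨w, -, h⟩ := adj_cases h
      omega
    · rintro rfl
      obtain ⟨hadj, hw⟩ := adj_down (r := r) (x := x) hi hjk
      refine ⟨hadj.symm, ?_⟩
      rw [Sym2.eq_swap, hw, hdist 0 (by omega), dist_zero hj₀ hjk]
      omega
  have hstep : ((grid k r x).graph.Adj (i₀ + 1, j + 1, a) (i₀ + 1, j + 1, a + 1) ∧
      dist k r i₀ j₀ (i₀ + 1, j + 1, a) = dist k r i₀ j₀ (i₀ + 1, j + 1, a + 1) +
        (grid k r x).weight s((i₀ + 1, j + 1, a), (i₀ + 1, j + 1, a + 1))) ↔ a + 1 ≤ 2 * r := by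
    constructor
    · rintro ⟨h, -⟩
      obtain ⟨w, -, h⟩ := adj_cases h
      omega
    · intro h
      obtain ⟨hadj, hw⟩ := adj_step (x := x) hi hjk h
      refine ⟨hadj.symm, ?_⟩
      rw [Sym2.eq_swap, hw, hdist _ ha, hdist _ h]
      omega
  have hskip : ((grid k r x).graph.Adj (i₀ + 1, j + 1, a) (i₀ + 1, j + 1, a + 2) ∧
      dist k r i₀ j₀ (i₀ + 1, j + 1, a) = dist k r i₀ j₀ (i₀ + 1, j + 1, a + 2) +
        (grid k r x).weight s((i₀ + 1, j + 1, a), (i₀ + 1, j + 1, a + 2))) ↔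
      a % 2 = 0 ∧ a + 2 ≤ 2 * r := by
    constructor
    · rintro ⟨h, -⟩
      obtain ⟨w, -, h⟩ := adj_cases h
      omega
    · intro h
      obtain ⟨hadj, hw⟩ := adj_skip (x := x) hi hjk h.1 h.2
      refine ⟨hadj.symm, ?_⟩
      rw [Sym2.eq_swap, hw, hdist _ ha, hdist _ h.2]
      omega
  have hfan : ((grid k r x).graph.Adj (i₀ + 1, j + 1, a) (i₀, j, 0) ∧
      dist k r i₀ j₀ (i₀ + 1, j + 1, a) = dist k r i₀ j₀ (i₀, j, 0) +
        (grid k r x).weight s((i₀ + 1, j + 1, a), (i₀, j, 0))) ↔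
      a % 2 = 0 ∧ x i₀ j / 2 ^ (a / 2) % 2 = 1 := by
    constructor
    · rintro ⟨h, -⟩
      obtain ⟨w, -, h⟩ := adj_cases h
      omega
    · intro h
      obtain ⟨hadj, hw⟩ := adj_fan hi hjk h.1 ha h.2
      refine ⟨hadj.symm, ?_⟩
      rw [Sym2.eq_swap, hw, hdist _ ha, dist_zero hj₀ (by omega)]
      omega
  rw [if_congr hup rfl rfl, if_congr hstep rfl rfl, if_congr hskip rfl rfl,
    if_congr hfan rfl rfl] at key
  convert key using 1
  have h0 : ∀ i j : ℕ, c (i, j, 0) = 1 := fun i j => by simp [hc]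
  have h1 : ∀ i' j' b : ℕ, c (i', j', b + 1) = x i₀ j / 2 ^ ((b + 2) / 2) := by
    intro i' j' b
    rw [hc]
    exact if_neg b.succ_ne_zero
  simp only [h0]
  rw [h1]
  -- Horner's scheme: at `2 * t` the digit `t` is added to two copies of `x / 2 ^ (t + 1)`, one by
  -- step and one by skip. At an odd vertex only the step from above is tight. For `a = 0` the
  -- vertical grid edge adds the extra `1`.
  rcases Nat.even_or_odd' a with ⟨t, rfl | rfl⟩
  · have e1 : (2 * t + 1) / 2 = t := by omega
    have e2 : 2 * t / 2 = t := by omega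
    have e3 : (2 * t + 2) / 2 = t + 1 := by omega
    have e4 : c (i₀ + 1, j + 1, 2 * t + 2) = x i₀ j / 2 ^ (t + 1) := by
      rw [h1]
      congr 2
      omega
    rw [e1, e2, e3, e4]
    have hdiv : x i₀ j / 2 ^ (t + 1) = x i₀ j / 2 ^ t / 2 := by
      rw [pow_succ, Nat.div_div_eq_div_mul]
    rcases Nat.lt_or_ge t r with htr | htr
    · rw [hdiv]
      split_ifs <;> omega
    -- At the top of the chain no step or skip arrives, and the quotient is the leading digit
    -- itself.
    · have : x i₀ j / 2 ^ t < 2 := by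
        rw [Nat.div_lt_iff_lt_mul (by positivity), ← pow_succ']
        exact hx.trans_le (Nat.pow_le_pow_right (by norm_num) (by omega))
      split_ifs <;> omega
  · have e1 : (2 * t + 1 + 1) / 2 = t + 1 := by omega
    have e2 : (2 * t + 1 + 2) / 2 = t + 1 := by omega
    rw [e1, e2, if_neg (by omega), if_pos (by omega), if_neg (by omega), if_neg (by omega)]
    omega
termination_by 2 * r - a

end

/-! ### Bounds on all numbers of shortest paths in the gadget grid. -/

section

variable {k r : ℕ} {x : ℕ → ℕ → ℕ}

theorem bounds_of_adj {i j a : ℕ} {v : ℕ × ℕ × ℕ} (h : (grid k r x).graph.Adj (i, j, a) v) :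
    i ≤ k ∧ j ≤ k ∧ a ≤ 2 * r ∧ (a ≠ 0 → 1 ≤ i ∧ 1 ≤ j) := by
  obtain ⟨i', j', a'⟩ := v
  obtain ⟨w, -, h⟩ := adj_cases h
  omega

theorem support_finite (k r : ℕ) (x : ℕ → ℕ → ℕ) : (grid k r x).graph.support.Finite := by
  refine ((Set.finite_Iic k).prod ((Set.finite_Iic k).prod (Set.finite_Iic (2 * r)))).subset ?_
  rintro ⟨i, j, a⟩ ⟨v, hv⟩
  have := bounds_of_adj hv
  exact ⟨this.1, this.2.1, this.2.2.1⟩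

/-- The number encoded by a cell is read off as the number of shortest paths between vertices in
its row and its column. -/
theorem numShortestPaths_lower_right {i₀ j₀ i j : ℕ} (hi₀ : i₀ ≤ i) (hj₀ : j₀ ≤ j)
    (hi : i + 1 ≤ k) (hj : j + 1 ≤ k) (hx : x i₀ j < 2 ^ (r + 1)) :
    (grid k r x).numShortestPaths (i₀, j₀, 0) (i + 1, j + 1, 0) = x i₀ j + 1 := by
  have key : Count k r i₀ j₀ x (i + 1, j + 1, 0) (x i₀ j + 1) := by
    induction i, hi₀ using Nat.le_induction with
    | base => simpa using count_gadget (a := 0) (by omega) hi hj₀ hj (by omega) hx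
    | succ i h ih =>
      exact count_down (by omega) (by omega) hi hj (by omega) (ih (by omega))
  exact key.numShortestPaths_eq (dist_self (by omega)) (dist_le_of_adj (by omega)) (by omega)

/-- Gadgets lead down to the right, so none is used when the target is not to the right of the
source. -/
theorem numShortestPaths_lower_left {i₀ j₀ i j : ℕ} (hi₀ : i₀ ≤ i) (hj : j ≤ j₀)
    (hi : i ≤ k) (hj₀ : j₀ ≤ k) :
    (grid k r x).numShortestPaths (i₀, j₀, 0) (i, j, 0) = 1 := by
  have key : Count k r i₀ j₀ x (i, j, 0) 1 := by
    induction i, hi₀ using Nat.le_induction with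
    | base => exact count_row hi hj₀ (by omega)
    | succ i h ih => exact count_down hj₀ h hi (by omega) (.inr hj) (ih (by omega))
  exact key.numShortestPaths_eq (dist_self hj₀) (dist_le_of_adj hj₀) one_pos

theorem numShortestPaths_row {i j₀ j : ℕ} (hi : i ≤ k) (hj : j ≤ k) (hj₀ : j₀ ≤ k) :
    (grid k r x).numShortestPaths (i, j₀, 0) (i, j, 0) = 1 :=
  (count_row hi hj₀ hj).numShortestPaths_eq (dist_self hj₀) (dist_le_of_adj hj₀) one_pos

theorem numShortestPaths_grid_le (hx : ∀ i j, x i j < 2 ^ (r + 1)) {i j i' j' : ℕ}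
    (hi : i ≤ k) (hj : j ≤ k) (hi' : i' ≤ k) (hj' : j' ≤ k) :
    (grid k r x).numShortestPaths (i, j, 0) (i', j', 0) ≤ 2 ^ (r + 1) := by
  wlog h : i ≤ i' generalizing i i' j j'
  · rw [numShortestPaths_comm]
    exact this hi' hj' hi hj (by omega)
  have h1 : 1 ≤ 2 ^ (r + 1) := Nat.one_le_two_pow
  rcases eq_or_lt_of_le h with rfl | h
  · exact (numShortestPaths_row hi hj' hj).trans_le h1
  rcases le_or_gt j' j with h2 | h2
  · exact (numShortestPaths_lower_left h.le h2 hi' hj).trans_le h1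
  · obtain ⟨i', rfl⟩ : ∃ n, i' = n + 1 := ⟨i' - 1, by omega⟩
    obtain ⟨j', rfl⟩ : ∃ n, j' = n + 1 := ⟨j' - 1, by omega⟩
    rw [numShortestPaths_lower_right (by omega) (by omega) hi' hj' (hx _ _)]
    exact hx _ _

/-- Within a gadget, one can walk along the steps. -/
theorem exists_walk_steps {i j a b : ℕ} (hi : i + 1 ≤ k) (hj : j + 1 ≤ k) (hab : b ≤ a)
    (ha : a ≤ 2 * r) : ∃ p : (grid k r x).graph.Walk (i + 1, j + 1, a) (i + 1, j + 1, b),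
      (grid k r x).walkLength p = a - b := by
  induction a, hab using Nat.le_induction with
  | base => exact ⟨.nil, by simp⟩
  | succ a h ih =>
    obtain ⟨p, hp⟩ := ih (by omega)
    obtain ⟨hadj, hw⟩ := adj_step (x := x) hi hj ha
    refine ⟨.cons hadj p, ?_⟩
    rw [walkLength_cons, hw, hp]
    omega

/-- The leading digit of `x i j` is one, so there is an edge to the top of the chain, from which
unit steps reach every chain vertex. Each of them thereby lies on a shortest walk between the two
corners. -/
theorem exists_walk_from_corner {i j a : ℕ} (hi : i + 1 ≤ k) (hj : j + 1 ≤ k)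
    (ha : a ≤ 2 * r) (hx : x i j < 2 ^ (r + 1)) (hx' : 2 ^ r ≤ x i j) :
    ∃ p : (grid k r x).graph.Walk (i, j, 0) (i + 1, j + 1, a),
      (grid k r x).walkLength p = vertWeight k r + i + 1 - a := by
  obtain ⟨p, hp⟩ := exists_walk_steps (x := x) hi hj ha le_rfl
  have hbit : x i j / 2 ^ (2 * r / 2) % 2 = 1 := by
    have h1 : x i j / 2 ^ r < 2 := by
      rw [Nat.div_lt_iff_lt_mul (by positivity), ← pow_succ']
      exact hx
    have h2 : 1 ≤ x i j / 2 ^ r := (Nat.one_le_div_iff (by positivity)).2 hx'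
    rw [Nat.mul_div_cancel_left r two_pos]
    omega
  obtain ⟨hadj, hw⟩ := adj_fan hi hj (by omega) le_rfl hbit
  refine ⟨.cons hadj p, ?_⟩
  rw [walkLength_cons, hw, hp, vertWeight]
  omega

theorem le_walkLength_corner_corner {i j : ℕ} (hj : j + 1 ≤ k)
    (p : (grid k r x).graph.Walk (i, j, 0) (i + 1, j + 1, 0)) :
    vertWeight k r + i + 1 ≤ (grid k r x).walkLength p := by
  have hjk : j ≤ k := by omega
  have h := (grid k r x).le_walkLength_of_potential (dist_le_of_adj (i₀ := i) hjk) p.reverse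
  rw [walkLength_reverse, dist_self hjk, dist_zero hjk hj] at h
  have h1 := gridDist_right k r i j i j
  have h2 := gridDist_down k r i j i (j + 1)
  omega

/-- Both corners together separate the interior of a gadget from the other vertices. -/
theorem corner_mem_support {i j : ℕ} {u v : ℕ × ℕ × ℕ} (p : (grid k r x).graph.Walk u v)
    (hu : ∃ a ≠ 0, u = (i + 1, j + 1, a)) (hv : ¬ ∃ a ≠ 0, v = (i + 1, j + 1, a)) :
    (i, j, 0) ∈ p.support ∨ (i + 1, j + 1, 0) ∈ p.support := by
  induction p with
  | nil => exact absurd hu hv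
  | @cons u y v e p ih =>
    by_cases hy : ∃ a ≠ 0, y = (i + 1, j + 1, a)
    · exact (ih hy hv).imp (List.mem_cons_of_mem _) (List.mem_cons_of_mem _)
    · obtain ⟨a, ha, rfl⟩ := hu
      obtain ⟨i', j', a'⟩ := y
      have hmem : (i', j', a') ∈ (SimpleGraph.Walk.cons e p).support :=
        List.mem_cons_of_mem _ p.start_mem_support
      simp only [Prod.mk.injEq, not_exists, not_and] at hy
      have hy' := hy a'
      obtain ⟨w, -, h⟩ := adj_cases e
      have : (i' = i ∧ j' = j ∧ a' = 0) ∨ (i' = i + 1 ∧ j' = j + 1 ∧ a' = 0) := by omega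
      rcases this with ⟨rfl, rfl, rfl⟩ | ⟨rfl, rfl, rfl⟩
      · exact .inl hmem
      · exact .inr hmem

theorem numShortestPaths_gadget_le (hx : ∀ i j, x i j < 2 ^ (r + 1))
    (hx' : ∀ i j, 2 ^ r ≤ x i j) {i j a b : ℕ} (hi : i + 1 ≤ k) (hj : j + 1 ≤ k)
    (ha : a ≤ 2 * r) (hb : b ≤ 2 * r) :
    (grid k r x).numShortestPaths (i + 1, j + 1, a) (i + 1, j + 1, b) ≤ 2 ^ (r + 1) := by
  wlog h : b ≤ a generalizing a b
  · rw [numShortestPaths_comm]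
    exact this hb ha (by omega)
  obtain ⟨p₁, h₁⟩ := exists_walk_from_corner hi hj ha (hx i j) (hx' i j)
  obtain ⟨p, hp⟩ := exists_walk_steps (x := x) hi hj h ha
  obtain ⟨p₂, h₂⟩ := exists_walk_steps (x := x) hi hj b.zero_le hb
  refine (numShortestPaths_le_of_geodesic _ (support_finite k r x) p₁ p p₂ fun q => ?_).trans
    (numShortestPaths_grid_le hx (i := i) (j := j) (by omega) (by omega) hi hj)
  have := le_walkLength_corner_corner hj q
  have hV : vertWeight k r = k + 2 * r + 2 := rfl
  omega

theorem numShortestPaths_corner_gadget_le (hx : ∀ i j, x i j < 2 ^ (r + 1))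
    (hx' : ∀ i j, 2 ^ r ≤ x i j) {i j b : ℕ} (hi : i + 1 ≤ k) (hj : j + 1 ≤ k)
    (hb : b ≤ 2 * r) :
    (grid k r x).numShortestPaths (i, j, 0) (i + 1, j + 1, b) ≤ 2 ^ (r + 1) := by
  obtain ⟨p, hp⟩ := exists_walk_from_corner hi hj hb (hx i j) (hx' i j)
  obtain ⟨p₂, h₂⟩ := exists_walk_steps (x := x) hi hj b.zero_le hb
  refine (numShortestPaths_le_of_geodesic _ (support_finite k r x) .nil p p₂ fun q => ?_).trans
    (numShortestPaths_grid_le hx (i := i) (j := j) (by omega) (by omega) hi hj)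
  have := le_walkLength_corner_corner hj q
  have hV : vertWeight k r = k + 2 * r + 2 := rfl
  rw [walkLength_nil]
  omega

/-- Every path leaving the gadget passes one of its two corners; each corner contributes at most `2
^ (r + 1)` initial pieces and `M` remaining ones. -/
theorem numShortestPaths_inner_le (hx : ∀ i j, x i j < 2 ^ (r + 1))
    (hx' : ∀ i j, 2 ^ r ≤ x i j) {i j a M : ℕ} {v : ℕ × ℕ × ℕ} (hi : i + 1 ≤ k)
    (hj : j + 1 ≤ k) (ha : a ≤ 2 * r) (ha0 : a ≠ 0) (hv : ¬ ∃ b ≠ 0, v = (i + 1, j + 1, b))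
    (hM : ∀ i j, i ≤ k → j ≤ k → (grid k r x).numShortestPaths (i, j, 0) v ≤ M) :
    (grid k r x).numShortestPaths (i + 1, j + 1, a) v ≤ 2 * (2 ^ (r + 1) * M) := by
  refine (numShortestPaths_le_of_separates _ (support_finite k r x)
    fun p => corner_mem_support p ⟨a, ha0, rfl⟩ hv).trans ?_
  rw [two_mul]
  refine Nat.add_le_add (Nat.mul_le_mul ?_ (hM _ _ (by omega) (by omega)))
    (Nat.mul_le_mul ?_ (hM _ _ hi hj))
  · rw [numShortestPaths_comm]
    exact numShortestPaths_corner_gadget_le hx hx' hi hj ha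
  · exact numShortestPaths_gadget_le hx hx' hi hj ha (Nat.zero_le _)

/-- The worst case joins interior vertices of two different gadgets: splitting at corners at both
ends gives three factors `2 ^ (r + 1)` and two factors `2`. For `r = 0` gadgets have no interior and
counts are at most `2`. -/
theorem numShortestPaths_lt {L : ℕ} (hL : r = 0 ∧ 2 ≤ L ∨ 3 * r + 6 ≤ L)
    (hx : ∀ i j, x i j < 2 ^ (r + 1)) (hx' : 0 < r → ∀ i j, 2 ^ r ≤ x i j) (u v : ℕ × ℕ × ℕ) :
    (grid k r x).numShortestPaths u v < 2 ^ L := by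
  have hone : 1 < 2 ^ L := Nat.one_lt_two_pow (by omega)
  by_cases hu : ∃ y, (grid k r x).graph.Adj u y
  swap
  · exact (numShortestPaths_le_one_of_isolated _ (not_exists.1 hu)).trans_lt hone
  by_cases hv : ∃ y, (grid k r x).graph.Adj v y
  swap
  · rw [numShortestPaths_comm]
    exact (numShortestPaths_le_one_of_isolated _ (not_exists.1 hv)).trans_lt hone
  obtain ⟨i, j, a⟩ := u
  obtain ⟨i', j', a'⟩ := v
  obtain ⟨hi, hj, ha, hpos⟩ := bounds_of_adj hu.choose_spec
  obtain ⟨hi', hj', ha', hpos'⟩ := bounds_of_adj hv.choose_spec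
  rcases Nat.eq_zero_or_pos r with hr | hr
  · obtain rfl : a = 0 := by omega
    obtain rfl : a' = 0 := by omega
    refine (numShortestPaths_grid_le hx hi hj hi' hj').trans_lt
      (Nat.pow_lt_pow_right one_lt_two (by omega))
  have hx' := hx' hr
  have hT : 2 * (2 ^ (r + 1) * (2 * (2 ^ (r + 1) * 2 ^ (r + 1)))) < 2 ^ L := by
    calc _ = 2 ^ (3 * r + 5) := by ring
      _ < 2 ^ L := Nat.pow_lt_pow_right one_lt_two (by omega)
  have hT1 : 1 ≤ 2 ^ (r + 1) := Nat.one_le_two_pow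
  have hTT : 2 ^ (r + 1) ≤ 2 ^ (r + 1) * 2 ^ (r + 1) := Nat.le_mul_of_pos_left _ hT1
  have hTTT : 2 ^ (r + 1) * 2 ^ (r + 1) ≤ 2 ^ (r + 1) * (2 * (2 ^ (r + 1) * 2 ^ (r + 1))) :=
    Nat.mul_le_mul_left _ (by omega)
  have hinner : ∀ (i j i' j' a : ℕ), i ≤ k → j ≤ k → i' ≤ k → j' ≤ k → a ≤ 2 * r →
      (a ≠ 0 → 1 ≤ i ∧ 1 ≤ j) → (grid k r x).numShortestPaths (i, j, a) (i', j', 0) ≤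
        2 * (2 ^ (r + 1) * 2 ^ (r + 1)) := by
    intro i j i' j' a hi hj hi' hj' ha hpos
    rcases eq_or_ne a 0 with rfl | ha0
    · exact (numShortestPaths_grid_le hx hi hj hi' hj').trans (by omega)
    · obtain ⟨i, rfl⟩ : ∃ n, i = n + 1 := ⟨i - 1, by have := hpos ha0; omega⟩
      obtain ⟨j, rfl⟩ : ∃ n, j = n + 1 := ⟨j - 1, by have := hpos ha0; omega⟩
      refine numShortestPaths_inner_le hx hx' hi hj ha ha0 ?_ fun p q hp hq =>
        numShortestPaths_grid_le hx hp hq hi' hj'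
      rintro ⟨b, hb, h⟩
      exact hb (by simpa using (congrArg (fun t => t.2.2) h).symm)
  rcases eq_or_ne a 0 with rfl | ha0
  · rw [numShortestPaths_comm]
    exact (hinner i' j' i j a' hi' hj' hi hj ha' hpos').trans_lt (by omega)
  · obtain ⟨i, rfl⟩ : ∃ n, i = n + 1 := ⟨i - 1, by have := hpos ha0; omega⟩
    obtain ⟨j, rfl⟩ : ∃ n, j = n + 1 := ⟨j - 1, by have := hpos ha0; omega⟩
    by_cases hv : ∃ b ≠ 0, (i', j', a') = (i + 1, j + 1, b)
    · obtain ⟨b, hb, h⟩ := hv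
      simp only [Prod.mk.injEq] at h
      obtain ⟨rfl, rfl, rfl⟩ := h
      exact (numShortestPaths_gadget_le hx hx' hi hj ha ha').trans_lt (by omega)
    · refine (numShortestPaths_inner_le hx hx' hi hj ha ha0 hv fun p q hp hq => ?_).trans_lt hT
      rw [numShortestPaths_comm]
      exact hinner i' j' p q a' hi' hj' hp hq ha' hpos'

end

end GadgetGrid

/-! ### Straight-line drawings certified by separating lines. -/

/-- The segments `PQ` and `RT` lie on different sides of a line which contains at most one of
them. -/
def Separated (P Q R T : ℤ × ℤ) : Prop :=
  ∃ α β γ : ℤ, α * P.1 + β * P.2 ≤ γ ∧ α * Q.1 + β * Q.2 ≤ γ ∧ γ ≤ α * R.1 + β * R.2 ∧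
    γ ≤ α * T.1 + β * T.2 ∧ (α * P.1 + β * P.2 < γ ∨ α * Q.1 + β * Q.2 < γ ∨
      γ < α * R.1 + β * R.2 ∨ γ < α * T.1 + β * T.2)

namespace Separated

variable {P Q R T : ℤ × ℤ}

theorem swap_left (h : Separated P Q R T) : Separated Q P R T := by
  obtain ⟨α, β, γ, h1, h2, h3, h4, h5⟩ := h
  exact ⟨α, β, γ, h2, h1, h3, h4, by tauto⟩

theorem swap_right (h : Separated P Q R T) : Separated P Q T R := by
  obtain ⟨α, β, γ, h1, h2, h3, h4, h5⟩ := h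
  exact ⟨α, β, γ, h1, h2, h4, h3, by tauto⟩

theorem symm (h : Separated P Q R T) : Separated R T P Q := by
  obtain ⟨α, β, γ, h1, h2, h3, h4, h5⟩ := h
  refine ⟨-α, -β, -γ, ?_⟩
  simp only [neg_mul]
  refine ⟨by linarith, by linarith, by linarith, by linarith, ?_⟩
  rcases h5 with h | h | h | h
  · exact .inr <| .inr <| .inl (by linarith)
  · exact .inr <| .inr <| .inr (by linarith)
  · exact .inl (by linarith)
  · exact .inr <| .inl (by linarith)

theorem of_fst (c : ℤ) (h : P.1 ≤ c ∧ Q.1 ≤ c ∧ c ≤ R.1 ∧ c ≤ T.1 ∧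
    (P.1 < c ∨ Q.1 < c ∨ c < R.1 ∨ c < T.1)) : Separated P Q R T :=
  ⟨1, 0, c, by simpa using h⟩

theorem of_snd (c : ℤ) (h : P.2 ≤ c ∧ Q.2 ≤ c ∧ c ≤ R.2 ∧ c ≤ T.2 ∧
    (P.2 < c ∨ Q.2 < c ∨ c < R.2 ∨ c < T.2)) : Separated P Q R T :=
  ⟨0, 1, c, by simpa using h⟩

/-- Points common to two separated segments are ends of one of them. -/
theorem eq_end (h : Separated P Q R T) {s t : ℝ} (hs : 0 ≤ s) (hs1 : s ≤ 1) (ht : 0 ≤ t)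
    (ht1 : t ≤ 1)
    (h1 : (1 - s) * P.1 + s * Q.1 = (1 - t) * R.1 + t * T.1)
    (h2 : (1 - s) * P.2 + s * Q.2 = (1 - t) * R.2 + t * T.2) :
    (s = 0 ∨ s = 1) ∨ ((t = 0 ∨ t = 1) ∧ (R ≠ T)) := by
  obtain ⟨α, β, γ, hP, hQ, hR, hT, hlt⟩ := h
  have hP' : (α : ℝ) * P.1 + β * P.2 ≤ γ := by exact_mod_cast hP
  have hQ' : (α : ℝ) * Q.1 + β * Q.2 ≤ γ := by exact_mod_cast hQ
  have hR' : (γ : ℝ) ≤ α * R.1 + β * R.2 := by exact_mod_cast hR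
  have hT' : (γ : ℝ) ≤ α * T.1 + β * T.2 := by exact_mod_cast hT
  set p : ℝ := γ - (α * P.1 + β * P.2) with hp
  set q : ℝ := γ - (α * Q.1 + β * Q.2) with hq
  set a : ℝ := α * R.1 + β * R.2 - γ with ha
  set b : ℝ := α * T.1 + β * T.2 - γ with hb
  have hp0 : 0 ≤ p := by linarith
  have hq0 : 0 ≤ q := by linarith
  have ha0 : 0 ≤ a := by linarith
  have hb0 : 0 ≤ b := by linarith
  have e1 : 0 ≤ (1 - s) * p := mul_nonneg (by linarith) hp0
  have e2 : 0 ≤ s * q := mul_nonneg hs hq0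
  have e3 : 0 ≤ (1 - t) * a := mul_nonneg (by linarith) ha0
  have e4 : 0 ≤ t * b := mul_nonneg ht hb0
  -- At a common point the functional takes a value both at most and at least `γ`. So all four
  -- nonnegative terms vanish, and the end with positive gap fixes `s` or `t`.
  have hsum : (1 - s) * p + s * q + (1 - t) * a + t * b = 0 := by
    rw [hp, hq, ha, hb]
    linear_combination -(α : ℝ) * h1 - (β : ℝ) * h2
  have f1 : (1 - s) * p = 0 := by linarith
  have f2 : s * q = 0 := by linarith
  have f3 : (1 - t) * a = 0 := by linarith
  have f4 : t * b = 0 := by linarith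
  rcases hlt with h | h | h | h
  · have : p ≠ 0 := by
      have : (α : ℝ) * P.1 + β * P.2 < γ := by exact_mod_cast h
      exact (show 0 < p by linarith).ne'
    exact .inl (.inr (by linarith [(mul_eq_zero.1 f1).resolve_right this]))
  · have : q ≠ 0 := by
      have : (α : ℝ) * Q.1 + β * Q.2 < γ := by exact_mod_cast h
      exact (show 0 < q by linarith).ne'
    exact .inl (.inl ((mul_eq_zero.1 f2).resolve_right this))
  · have h' : (γ : ℝ) < α * R.1 + β * R.2 := by exact_mod_cast h
    have : a ≠ 0 := (show 0 < a by linarith).ne'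
    have ht : t = 1 := by linarith [(mul_eq_zero.1 f3).resolve_right this]
    refine .inr ⟨.inr ht, ?_⟩
    rintro rfl
    rw [ht, one_mul] at f4
    linarith
  · have h' : (γ : ℝ) < α * T.1 + β * T.2 := by exact_mod_cast h
    have : b ≠ 0 := (show 0 < b by linarith).ne'
    have ht : t = 0 := (mul_eq_zero.1 f4).resolve_right this
    refine .inr ⟨.inl ht, ?_⟩
    rintro rfl
    rw [ht, sub_zero, one_mul] at f3
    linarith

end Separated

/-- A straight-line drawing on integer points in which edges are separated from each other and from
the vertices is a plane embedding. -/
theorem isPlanar_of_separated {V : Type*} (G : SimpleGraph V) (pt : V → ℤ × ℤ)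
    (hpt : Function.Injective pt)
    (hedge : ∀ u v x y, G.Adj u v → G.Adj x y → s(u, v) ≠ s(x, y) →
      Separated (pt u) (pt v) (pt x) (pt y))
    (hvertex : ∀ u v x, G.Adj u v → x ≠ u → x ≠ v → Separated (pt u) (pt v) (pt x) (pt x)) :
    IsPlanar G := by
  set pos : V → ℝ × ℝ := fun v => (((pt v).1 : ℝ), ((pt v).2 : ℝ)) with hpos
  have hinj : Function.Injective pos := by
    intro u v h
    simp only [hpos, Prod.mk.injEq, Int.cast_inj] at h
    exact hpt (Prod.ext h.1 h.2)
  set src : G.edgeSet → V := fun e => (Quot.out (e : Sym2 V)).1 with hsrc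
  set tgt : G.edgeSet → V := fun e => (Quot.out (e : Sym2 V)).2 with htgt
  have hst : ∀ e : G.edgeSet, s(src e, tgt e) = (e : Sym2 V) := fun e => Quot.out_eq (e : Sym2 V)
  have hadj : ∀ e : G.edgeSet, G.Adj (src e) (tgt e) := fun e => by
    rw [← SimpleGraph.mem_edgeSet, hst]
    exact e.2
  set arc : G.edgeSet → C(unitInterval, ℝ × ℝ) := fun e =>
    ⟨fun t => ((1 - (t : ℝ)) * (pos (src e)).1 + t * (pos (tgt e)).1,
      (1 - (t : ℝ)) * (pos (src e)).2 + t * (pos (tgt e)).2), by fun_prop⟩ with harc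
  have harc1 : ∀ e t, (arc e t).1 = (1 - (t : ℝ)) * (pt (src e)).1 + t * (pt (tgt e)).1 :=
    fun _ _ => rfl
  have harc2 : ∀ e t, (arc e t).2 = (1 - (t : ℝ)) * (pt (src e)).2 + t * (pt (tgt e)).2 :=
    fun _ _ => rfl
  have h0 : ∀ e (t : unitInterval), (t : ℝ) = 0 → arc e t = pos (src e) := fun e t ht => by
    ext <;> simp [harc, ht]
  have h1 : ∀ e (t : unitInterval), (t : ℝ) = 1 → arc e t = pos (tgt e) := fun e t ht => by
    ext <;> simp [harc, ht]
  refine ⟨⟨pos, arc, hinj, fun e s t h => ?_, fun e => ?_, fun e t v h => ?_,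
    fun e e' hne t t' h => ?_⟩⟩
  · have e1 := congrArg Prod.fst h
    have e2 := congrArg Prod.snd h
    rw [harc1, harc1] at e1
    rw [harc2, harc2] at e2
    by_contra hne
    have hne' : (s : ℝ) - t ≠ 0 := fun h => hne (Subtype.ext (by linarith))
    refine (hadj e).ne (hinj (Prod.ext ?_ ?_))
    · exact (mul_left_cancel₀ hne' (show ((s : ℝ) - t) * (pos (src e)).1 = _ * (pos (tgt e)).1 by
        simp only [hpos]; linarith))
    · exact (mul_left_cancel₀ hne' (show ((s : ℝ) - t) * (pos (src e)).2 = _ * (pos (tgt e)).2 by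
        simp only [hpos]; linarith))
  · rw [h0 e 0 (by simp), h1 e 1 (by simp), ← hst e, Sym2.map_mk]
  · rw [← hst e, Sym2.mem_iff]
    by_contra hv
    rw [not_or] at hv
    have e1 := congrArg Prod.fst h
    have e2 := congrArg Prod.snd h
    rw [harc1] at e1
    rw [harc2] at e2
    -- The vertex is a degenerate segment, which excludes the alternative `R ≠ T` of `eq_end`.
    have := (hvertex _ _ v (hadj e) hv.1 hv.2).eq_end t.2.1 t.2.2 le_rfl zero_le_one
      (by rw [e1]; simp [hpos]) (by rw [e2]; simp [hpos])
    rcases this with (ht | ht) | ⟨-, h⟩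
    · exact hv.1 (hinj (h ▸ h0 e t ht))
    · exact hv.2 (hinj (h ▸ h1 e t ht))
    · exact h rfl
  · have e1 := congrArg Prod.fst h
    have e2 := congrArg Prod.snd h
    rw [harc1, harc1] at e1
    rw [harc2, harc2] at e2
    have hne' : s(src e, tgt e) ≠ s(src e', tgt e') := by
      rw [hst, hst]
      exact fun h => hne (Subtype.ext h)
    rcases (hedge _ _ _ _ (hadj e) (hadj e') hne').eq_end t.2.1 t.2.2 t'.2.1 t'.2.2 e1 e2 with
      (ht | ht) | ⟨ht | ht, -⟩
    · exact ⟨_, h0 e t ht⟩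
    · exact ⟨_, h1 e t ht⟩
    · exact ⟨_, h.trans (h0 e' t' ht)⟩
    · exact ⟨_, h.trans (h1 e' t' ht)⟩

/-! ### A plane drawing of the gadget grid. -/

namespace GadgetGrid

/-- The side length of a cell in the drawing of the gadget grid. -/
def cellSize (r : ℕ) : ℤ := 4 * r + 4

/-- The position of a vertex in the drawing of the gadget grid. -/
def position (r : ℕ) : ℕ × ℕ × ℕ → ℤ × ℤ
  -- Even chain vertices lie on the line of slope two through the lower right corner, odd ones one
  -- unit off it, on the side away from the upper left corner. Displacements are at most `4 * r`, so
  -- the chain stays inside its cell.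
  | (i, j, a) => (cellSize r * j - a, cellSize r * i - 2 * a - (a % 2 : ℕ))

theorem cellSize_gap (r m n : ℕ) :
    m = n ∨ cellSize r * m + cellSize r ≤ cellSize r * n ∨
      cellSize r * n + cellSize r ≤ cellSize r * m := by
  have key : ∀ a b : ℕ, a < b → cellSize r * a + cellSize r ≤ cellSize r * b := by
    intro a b h
    have h1 : (a : ℤ) + 1 ≤ b := by exact_mod_cast h
    have h2 : 0 ≤ cellSize r := by rw [cellSize]; positivity
    nlinarith
  rcases lt_trichotomy m n with h | h | h
  · exact .inr (.inl (key _ _ h))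
  · exact .inl h
  · exact .inr (.inr (key _ _ h))

theorem position_injOn (r : ℕ) : Set.InjOn (position r) {v | v.2.2 ≤ 2 * r} := by
  rintro ⟨i, j, a⟩ ha ⟨i', j', a'⟩ ha' h
  simp only [Set.mem_ofPred_eq, position, Prod.mk.injEq] at ha ha' h ⊢
  have hS : cellSize r = 4 * r + 4 := rfl
  obtain ⟨h1, h2⟩ := h
  have hj : j = j' := by
    rcases cellSize_gap r j j' with h | h | h
    · exact h
    all_goals omega
  subst hj
  obtain rfl : a = a' := by omega
  rcases cellSize_gap r i i' with h | h | h
  · exact ⟨h, rfl, rfl⟩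
  all_goals omega

section

variable {r : ℕ} {P Q R T : ℤ × ℤ}

/-- The segment `PQ` is the horizontal grid edge starting in row `i` and column `j`. -/
def IsHorizontal (r : ℕ) (P Q : ℤ × ℤ) (i j : ℕ) : Prop :=
  P = (cellSize r * j, cellSize r * i) ∧ Q = (cellSize r * j + cellSize r, cellSize r * i)

/-- The segment `PQ` is the vertical grid edge starting in row `i` and column `j`. -/
def IsVertical (r : ℕ) (P Q : ℤ × ℤ) (i j : ℕ) : Prop :=
  P = (cellSize r * j, cellSize r * i) ∧ Q = (cellSize r * j, cellSize r * i + cellSize r)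

/-- The segment `PQ` joins the upper left corner of the cell with lower right corner `(i, j)` to
the gadget vertex `a`. -/
def IsFan (r : ℕ) (P Q : ℤ × ℤ) (i j a : ℕ) : Prop :=
  P = (cellSize r * j - cellSize r, cellSize r * i - cellSize r) ∧
    Q = (cellSize r * j - a, cellSize r * i - 2 * a) ∧ a % 2 = 0 ∧ a ≤ 2 * r

/-- The segment `PQ` joins the vertices `b` and `a` of the gadget in the cell with lower right
corner `(i, j)`. -/
def IsChain (r : ℕ) (P Q : ℤ × ℤ) (i j a b : ℕ) : Prop :=
  P = (cellSize r * j - b, cellSize r * i - 2 * b - (b % 2 : ℕ)) ∧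
    Q = (cellSize r * j - a, cellSize r * i - 2 * a - (a % 2 : ℕ)) ∧ b ≤ 2 * r ∧
      (b = a + 1 ∨ b = a + 2 ∧ a % 2 = 0)

theorem Link.shape {k : ℕ} {x : ℕ → ℕ → ℕ} {u v : ℕ × ℕ × ℕ} (h : Link k r x u v) :
    (∃ i j, u = (i, j, 0) ∧ v = (i, j + 1, 0) ∧
      IsHorizontal r (position r u) (position r v) i j) ∨
    (∃ i j, u = (i, j, 0) ∧ v = (i + 1, j, 0) ∧
      IsVertical r (position r u) (position r v) i j) ∨
    (∃ i j a, u = (i, j, 0) ∧ v = (i + 1, j + 1, a) ∧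
      IsFan r (position r u) (position r v) (i + 1) (j + 1) a) ∨
    (∃ i j a b, u = (i, j, b) ∧ v = (i, j, a) ∧
      IsChain r (position r u) (position r v) i j a b) := by
  obtain ⟨i, j, a⟩ := u
  obtain ⟨i', j', a'⟩ := v
  rcases h with ⟨rfl, rfl, rfl, rfl, h1, h2⟩ | ⟨rfl, rfl, rfl, rfl, h1, h2⟩ |
    ⟨rfl, rfl, rfl, h1, h2, h3, h4, h5⟩ | ⟨rfl, rfl, h1, h2, h3, h4, rfl, h6⟩ |
    ⟨rfl, rfl, h1, h2, h3, h4, rfl, h6, h7⟩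
  · refine .inl ⟨i', j, rfl, rfl, ?_, ?_⟩ <;> simp [position, mul_add]
  · refine .inr <| .inl ⟨i, j', rfl, rfl, ?_, ?_⟩ <;> simp [position, mul_add]
  · refine .inr <| .inr <| .inl ⟨i, j, a', rfl, rfl, ?_, ?_, h1, h2⟩
    · simp [position, mul_add]
    · simp [position, h1]
  · exact .inr <| .inr <| .inr ⟨i', j', a', a' + 1, rfl, rfl, rfl, rfl, h6, .inl rfl⟩
  · exact .inr <| .inr <| .inr ⟨i', j', a', a' + 2, rfl, rfl, rfl, rfl, h7, .inr ⟨rfl, h6⟩⟩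

/-- The segment `PQ` lies in the cell with lower right corner `(i, j)`, and is not parallel to its
sides. -/
def InCell (r : ℕ) (P Q : ℤ × ℤ) (i j : ℕ) : Prop :=
  cellSize r * j - cellSize r ≤ P.1 ∧ cellSize r * j - cellSize r ≤ Q.1 ∧ P.1 ≤ cellSize r * j ∧
    Q.1 ≤ cellSize r * j ∧ cellSize r * i - cellSize r ≤ P.2 ∧ cellSize r * i - cellSize r ≤ Q.2 ∧
    P.2 ≤ cellSize r * i ∧ Q.2 ≤ cellSize r * i ∧ P.1 ≠ Q.1 ∧ P.2 ≠ Q.2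

theorem IsFan.inCell {i j a : ℕ} (h : IsFan r P Q i j a) : InCell r P Q i j := by
  obtain ⟨rfl, rfl, h1, h2⟩ := h
  have hS : cellSize r = 4 * r + 4 := rfl
  simp only [InCell]
  refine ⟨?_, ?_, ?_, ?_, ?_, ?_, ?_, ?_, ?_, ?_⟩ <;> omega

theorem IsChain.inCell {i j a b : ℕ} (h : IsChain r P Q i j a b) : InCell r P Q i j := by
  obtain ⟨rfl, rfl, h1, h2⟩ := h
  have hS : cellSize r = 4 * r + 4 := rfl
  simp only [InCell]
  refine ⟨?_, ?_, ?_, ?_, ?_, ?_, ?_, ?_, ?_, ?_⟩ <;> omega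

theorem InCell.separated_of_ne {i j i' j' : ℕ} (h : InCell r P Q i j) (h' : InCell r R T i' j')
    (hne : i ≠ i' ∨ j ≠ j') : Separated P Q R T := by
  simp only [InCell] at h h'
  rcases cellSize_gap r i i' with e | e | e
  · rcases cellSize_gap r j j' with e' | e' | e'
    · omega
    · exact .of_fst (cellSize r * j) (by omega)
    · exact (Separated.of_fst (cellSize r * j') (by omega)).symm
  · exact .of_snd (cellSize r * i) (by omega)
  · exact (Separated.of_snd (cellSize r * i') (by omega)).symm

theorem IsHorizontal.separated_inCell {i j i' j' : ℕ} (h : IsHorizontal r P Q i j)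
    (h' : InCell r R T i' j') : Separated P Q R T := by
  obtain ⟨rfl, rfl⟩ := h
  simp only [InCell] at h'
  rcases cellSize_gap r i i' with e | e | e
  · subst e
    exact (Separated.of_snd (cellSize r * i) (by simp only; omega)).symm
  · exact .of_snd (cellSize r * i) (by simp only; omega)
  · exact (Separated.of_snd (cellSize r * i) (by
      have hS : cellSize r = 4 * r + 4 := rfl
      simp only; omega)).symm

theorem IsVertical.separated_inCell {i j i' j' : ℕ} (h : IsVertical r P Q i j)
    (h' : InCell r R T i' j') : Separated P Q R T := by
  obtain ⟨rfl, rfl⟩ := h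
  simp only [InCell] at h'
  rcases cellSize_gap r j j' with e | e | e
  · subst e
    exact (Separated.of_fst (cellSize r * j) (by simp only; omega)).symm
  · exact .of_fst (cellSize r * j) (by simp only; omega)
  · exact (Separated.of_fst (cellSize r * j) (by
      have hS : cellSize r = 4 * r + 4 := rfl
      simp only; omega)).symm

theorem IsHorizontal.separated {i j i' j' : ℕ} (h : IsHorizontal r P Q i j)
    (h' : IsHorizontal r R T i' j') (hne : i ≠ i' ∨ j ≠ j') : Separated P Q R T := by
  obtain ⟨rfl, rfl⟩ := h
  obtain ⟨rfl, rfl⟩ := h'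
  have hS : cellSize r = 4 * r + 4 := rfl
  rcases cellSize_gap r i i' with e | e | e
  · rcases cellSize_gap r j j' with e' | e' | e'
    · omega
    · exact .of_fst (cellSize r * j') (by simp only; omega)
    · exact (Separated.of_fst (cellSize r * j) (by simp only; omega)).symm
  · exact .of_snd (cellSize r * i') (by simp only; omega)
  · exact (Separated.of_snd (cellSize r * i) (by simp only; omega)).symm

theorem IsVertical.separated {i j i' j' : ℕ} (h : IsVertical r P Q i j)
    (h' : IsVertical r R T i' j') (hne : i ≠ i' ∨ j ≠ j') : Separated P Q R T := by
  obtain ⟨rfl, rfl⟩ := h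
  obtain ⟨rfl, rfl⟩ := h'
  have hS : cellSize r = 4 * r + 4 := rfl
  rcases cellSize_gap r j j' with e | e | e
  · rcases cellSize_gap r i i' with e' | e' | e'
    · omega
    · exact .of_snd (cellSize r * i') (by simp only; omega)
    · exact (Separated.of_snd (cellSize r * i) (by simp only; omega)).symm
  · exact .of_fst (cellSize r * j') (by simp only; omega)
  · exact (Separated.of_fst (cellSize r * j) (by simp only; omega)).symm

theorem IsHorizontal.separated_isVertical {i j i' j' : ℕ} (h : IsHorizontal r P Q i j)
    (h' : IsVertical r R T i' j') : Separated P Q R T := by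
  obtain ⟨rfl, rfl⟩ := h
  obtain ⟨rfl, rfl⟩ := h'
  have hS : cellSize r = 4 * r + 4 := rfl
  rcases cellSize_gap r j j' with e | e | e
  · subst e
    exact (Separated.of_fst (cellSize r * j) (by simp only; omega)).symm
  · exact .of_fst (cellSize r * j') (by simp only; omega)
  · exact (Separated.of_fst (cellSize r * j) (by simp only; omega)).symm

/-- Within a cell, the links of the chain lie below the line through its even vertices. -/
theorem IsChain.separated_isFan {i j a b c : ℕ} (h : IsChain r P Q i j a b)
    (h' : IsFan r R T i j c) : Separated P Q R T := by
  obtain ⟨rfl, rfl, h1, h2⟩ := h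
  obtain ⟨rfl, rfl, h3, h4⟩ := h'
  have hS : cellSize r = 4 * r + 4 := rfl
  refine ⟨-2, 1, cellSize r * i - 2 * (cellSize r * j), ?_⟩
  simp only
  refine ⟨?_, ?_, ?_, ?_, ?_⟩ <;> omega

/-- Both segments start in the same corner, and the line through the first one separates them: the
relevant cross product is `cellSize r * (b - a)`. -/
theorem IsFan.separated_of_lt {i j a b : ℕ} (h : IsFan r P Q i j a) (h' : IsFan r R T i j b)
    (hab : a < b) : Separated P Q R T := by
  obtain ⟨rfl, rfl, h1, h2⟩ := h
  obtain ⟨rfl, rfl, h3, h4⟩ := h'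
  have hS : 0 < cellSize r := by rw [cellSize]; positivity
  have hab' : (0 : ℤ) < b - a := by
    have : (a : ℤ) < b := by exact_mod_cast hab
    linarith
  have := mul_pos hS hab'
  refine ⟨cellSize r - 2 * a, -(cellSize r - a),
    (cellSize r - 2 * a) * (cellSize r * j - cellSize r) -
      (cellSize r - a) * (cellSize r * i - cellSize r), ?_⟩
  simp only
  refine ⟨by linarith, by linarith, by linarith, by linarith, .inr <| .inr <| .inr <| by linarith⟩

/-- Links over non-overlapping ranges are separated by a vertical line. Two different overlapping
links are a skip, lying on the line of slope two, and a unit step, which touches that line only at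
its even end. -/
theorem IsChain.separated {i j a b c d : ℕ} (h : IsChain r P Q i j a b)
    (h' : IsChain r R T i j c d) (hne : a ≠ c ∨ b ≠ d) : Separated P Q R T := by
  obtain ⟨rfl, rfl, h1, h2⟩ := h
  obtain ⟨rfl, rfl, h3, h4⟩ := h'
  rcases le_or_gt d a with h5 | h5
  · exact .of_fst (cellSize r * j - a) (by simp only; omega)
  rcases le_or_gt b c with h6 | h6
  · exact (Separated.of_fst (cellSize r * j - c) (by simp only; omega)).symm
  rcases h2 with h2 | h2
  · refine ⟨-2, 1, cellSize r * i - 2 * (cellSize r * j), ?_⟩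
    simp only
    refine ⟨?_, ?_, ?_, ?_, ?_⟩ <;> omega
  · refine Separated.symm ⟨-2, 1, cellSize r * i - 2 * (cellSize r * j), ?_⟩
    simp only
    refine ⟨?_, ?_, ?_, ?_, ?_⟩ <;> omega

theorem IsHorizontal.separated_vertex {i j i' j' c : ℕ} (h : IsHorizontal r P Q i j)
    (hc : c ≤ 2 * r) : Separated P Q (position r (i', j', c)) (position r (i', j', c)) := by
  obtain ⟨rfl, rfl⟩ := h
  have hS : cellSize r = 4 * r + 4 := rfl
  simp only [position]
  rcases cellSize_gap r i i' with e | e | e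
  · subst e
    rcases Nat.eq_zero_or_pos c with rfl | hc0
    · rcases cellSize_gap r j j' with e' | e' | e'
      · subst e'
        exact (Separated.of_fst (cellSize r * j) (by simp; omega)).symm
      · exact .of_fst (cellSize r * j') (by simp; omega)
      · exact (Separated.of_fst (cellSize r * j) (by simp; omega)).symm
    · exact (Separated.of_snd (cellSize r * i) (by simp only; omega)).symm
  · exact .of_snd (cellSize r * i) (by simp only; omega)
  · exact (Separated.of_snd (cellSize r * i) (by simp only; omega)).symm

theorem IsVertical.separated_vertex {i j i' j' c : ℕ} (h : IsVertical r P Q i j)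
    (hc : c ≤ 2 * r) : Separated P Q (position r (i', j', c)) (position r (i', j', c)) := by
  obtain ⟨rfl, rfl⟩ := h
  have hS : cellSize r = 4 * r + 4 := rfl
  simp only [position]
  rcases cellSize_gap r j j' with e | e | e
  · subst e
    rcases Nat.eq_zero_or_pos c with rfl | hc0
    · rcases cellSize_gap r i i' with e' | e' | e'
      · subst e'
        exact (Separated.of_snd (cellSize r * i) (by simp; omega)).symm
      · exact .of_snd (cellSize r * i') (by simp; omega)
      · exact (Separated.of_snd (cellSize r * i) (by simp; omega)).symm
    · exact (Separated.of_fst (cellSize r * j) (by simp only; omega)).symm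
  · exact .of_fst (cellSize r * j) (by simp only; omega)
  · exact (Separated.of_fst (cellSize r * j) (by simp only; omega)).symm

theorem InCell.separated_vertex_of_ne {i j i' j' c : ℕ} (h : InCell r P Q i j) (hc : c ≤ 2 * r)
    (hne : i ≠ i' ∨ j ≠ j') :
    Separated P Q (position r (i', j', c)) (position r (i', j', c)) := by
  have hS : cellSize r = 4 * r + 4 := rfl
  simp only [InCell] at h
  simp only [position]
  rcases cellSize_gap r i i' with e | e | e
  · rcases cellSize_gap r j j' with e' | e' | e'
    · omega
    · exact .of_fst (cellSize r * j) (by simp only; omega)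
    · exact (Separated.of_fst (cellSize r * j') (by simp only; omega)).symm
  · exact .of_snd (cellSize r * i) (by simp only; omega)
  · exact (Separated.of_snd (cellSize r * i') (by simp only; omega)).symm

/-- An even vertex is off the line through the segment by the cross product `cellSize r * (c - a)`,
of either sign; an odd vertex lies strictly beyond the line of slope two. -/
theorem IsFan.separated_vertex {i j a c : ℕ} (h : IsFan r P Q i j a) (hc : c ≤ 2 * r)
    (hne : c ≠ a) : Separated P Q (position r (i, j, c)) (position r (i, j, c)) := by
  rcases Nat.mod_two_eq_zero_or_one c with hc2 | hc2
  · have hfan : IsFan r (cellSize r * j - cellSize r, cellSize r * i - cellSize r)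
        (position r (i, j, c)) i j c := ⟨rfl, by simp [position, hc2], hc2, hc⟩
    have hS : 0 < cellSize r := by rw [cellSize]; positivity
    obtain ⟨rfl, rfl, h1, h2⟩ := h
    simp only [position, hc2]
    have hca : (c : ℤ) - a ≠ 0 := by
      rw [sub_ne_zero]
      exact_mod_cast hne
    rcases lt_or_gt_of_ne hca with h3 | h3
    · have := mul_pos_of_neg_of_neg (neg_lt_zero.2 hS) h3
      refine ⟨-(cellSize r - 2 * a), cellSize r - a,
        -((cellSize r - 2 * a) * (cellSize r * j - cellSize r) -
          (cellSize r - a) * (cellSize r * i - cellSize r)), ?_⟩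
      simp only [Nat.cast_zero]
      refine ⟨by linarith, by linarith, by linarith, by linarith,
        .inr <| .inr <| .inr <| by linarith⟩
    · have := mul_pos hS h3
      refine ⟨cellSize r - 2 * a, -(cellSize r - a),
        (cellSize r - 2 * a) * (cellSize r * j - cellSize r) -
          (cellSize r - a) * (cellSize r * i - cellSize r), ?_⟩
      simp only [Nat.cast_zero]
      refine ⟨by linarith, by linarith, by linarith, by linarith,
        .inr <| .inr <| .inr <| by linarith⟩
  · obtain ⟨rfl, rfl, h1, h2⟩ := h
    have hS : cellSize r = 4 * r + 4 := rfl
    refine Separated.symm ⟨-2, 1, cellSize r * i - 2 * (cellSize r * j), ?_⟩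
    simp only [position]
    refine ⟨?_, ?_, ?_, ?_, ?_⟩ <;> omega

theorem IsChain.separated_vertex {i j a b c : ℕ} (h : IsChain r P Q i j a b) : Separated P Q (position r (i, j, c)) (position r (i, j, c)) := by
  obtain ⟨rfl, rfl, h1, h2⟩ := h
  simp only [position]
  rcases le_or_gt c a with h3 | h3
  · exact .of_fst (cellSize r * j - a) (by simp only; omega)
  rcases le_or_gt b c with h4 | h4
  · exact (Separated.of_fst (cellSize r * j - b) (by simp only; omega)).symm
  · refine Separated.symm ⟨-2, 1, cellSize r * i - 2 * (cellSize r * j), ?_⟩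
    simp only
    refine ⟨?_, ?_, ?_, ?_, ?_⟩ <;> omega

theorem Link.separated {k : ℕ} {x : ℕ → ℕ → ℕ} {u v u' v' : ℕ × ℕ × ℕ} (h : Link k r x u v)
    (h' : Link k r x u' v') (hne : (u, v) ≠ (u', v')) :
    Separated (position r u) (position r v) (position r u') (position r v') := by
  rcases h.shape with ⟨i, j, hu, hv, h⟩ | ⟨i, j, hu, hv, h⟩ | ⟨i, j, a, hu, hv, h⟩ |
      ⟨i, j, a, b, hu, hv, h⟩ <;>
    rcases h'.shape with ⟨i', j', hu', hv', h'⟩ | ⟨i', j', hu', hv', h'⟩ |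
      ⟨i', j', a', hu', hv', h'⟩ | ⟨i', j', a', b', hu', hv', h'⟩
  · refine h.separated h' ?_
    by_contra! hc
    obtain ⟨rfl, rfl⟩ := hc
    exact hne (by rw [hu, hv, hu', hv'])
  · exact h.separated_isVertical h'
  · exact h.separated_inCell h'.inCell
  · exact h.separated_inCell h'.inCell
  · exact (h'.separated_isVertical h).symm
  · refine h.separated h' ?_
    by_contra! hc
    obtain ⟨rfl, rfl⟩ := hc
    exact hne (by rw [hu, hv, hu', hv'])
  · exact h.separated_inCell h'.inCell
  · exact h.separated_inCell h'.inCell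
  · exact (h'.separated_inCell h.inCell).symm
  · exact (h'.separated_inCell h.inCell).symm
  · by_cases hc : i = i' ∧ j = j'
    · obtain ⟨rfl, rfl⟩ := hc
      rcases lt_trichotomy a a' with ha | rfl | ha
      · exact h.separated_of_lt h' ha
      · exact absurd (by rw [hu, hv, hu', hv']) hne
      · exact (h'.separated_of_lt h ha).symm
    · exact h.inCell.separated_of_ne h'.inCell (by omega)
  · by_cases hc : i + 1 = i' ∧ j + 1 = j'
    · obtain ⟨rfl, rfl⟩ := hc
      exact (h'.separated_isFan h).symm
    · exact h.inCell.separated_of_ne h'.inCell (by omega)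
  · exact (h'.separated_inCell h.inCell).symm
  · exact (h'.separated_inCell h.inCell).symm
  · by_cases hc : i = i' + 1 ∧ j = j' + 1
    · obtain ⟨rfl, rfl⟩ := hc
      exact h.separated_isFan h'
    · exact h.inCell.separated_of_ne h'.inCell (by omega)
  · by_cases hc : i = i' ∧ j = j'
    · obtain ⟨rfl, rfl⟩ := hc
      refine h.separated h' ?_
      by_contra! hc
      obtain ⟨rfl, rfl⟩ := hc
      exact hne (by rw [hu, hv, hu', hv'])
    · exact h.inCell.separated_of_ne h'.inCell (by omega)

theorem Link.separated_vertex {k : ℕ} {x : ℕ → ℕ → ℕ} {u v w : ℕ × ℕ × ℕ} (h : Link k r x u v)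
    (hwr : w.2.2 ≤ 2 * r) (hwu : w ≠ u) (hwv : w ≠ v) :
    Separated (position r u) (position r v) (position r w) (position r w) := by
  obtain ⟨i', j', c⟩ := w
  rcases h.shape with ⟨i, j, hu, hv, h⟩ | ⟨i, j, hu, hv, h⟩ | ⟨i, j, a, hu, hv, h⟩ |
      ⟨i, j, a, b, hu, hv, h⟩
  · exact h.separated_vertex hwr
  · exact h.separated_vertex hwr
  · by_cases hc : i + 1 = i' ∧ j + 1 = j'
    · obtain ⟨rfl, rfl⟩ := hc
      exact h.separated_vertex hwr fun hc => hwv (by rw [hv, hc])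
    · exact h.inCell.separated_vertex_of_ne hwr (by omega)
  · by_cases hc : i = i' ∧ j = j'
    · obtain ⟨rfl, rfl⟩ := hc
      exact h.separated_vertex
    · exact h.inCell.separated_vertex_of_ne hwr (by omega)

end

/-- Every finite part of the gadget grid is planar. -/
theorem isPlanar_comap {V : Type*} {k r : ℕ} {x : ℕ → ℕ → ℕ} (f : V → ℕ × ℕ × ℕ)
    (hf : Function.Injective f) (hfr : ∀ v, (f v).2.2 ≤ 2 * r) :
    IsPlanar ((grid k r x).graph.comap f) := by
  refine isPlanar_of_separated _ (fun v => position r (f v)) (fun u v h =>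
    hf (position_injOn r (hfr u) (hfr v) h)) (fun u v y z h h' hne => ?_) fun u v w h hu hv => ?_
  · have h1 : (f u, f v) ≠ (f y, f z) := fun h => hne (by
      rw [hf (Prod.mk.inj h).1, hf (Prod.mk.inj h).2])
    have h2 : (f u, f v) ≠ (f z, f y) := fun h => hne (by
      rw [hf (Prod.mk.inj h).1, hf (Prod.mk.inj h).2, Sym2.eq_swap])
    have h3 : (f v, f u) ≠ (f y, f z) := fun h => h2 (by
      rw [(Prod.mk.inj h).1, (Prod.mk.inj h).2])
    have h4 : (f v, f u) ≠ (f z, f y) := fun h => h1 (by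
      rw [(Prod.mk.inj h).1, (Prod.mk.inj h).2])
    rcases h with h | h <;> rcases h' with h' | h'
    · exact h.separated h' h1
    · exact (h.separated h' h2).swap_right
    · exact (h.separated h' h3).swap_left
    · exact (h.separated h' h4).swap_left.swap_right
  · rcases h with h | h
    · exact h.separated_vertex (hfr w) (hf.ne hu) (hf.ne hv)
    · exact (h.separated_vertex (hfr w) (hf.ne hv) (hf.ne hu)).swap_left

end GadgetGrid

/-! ### Restriction to a vertex set closed under adjacency. -/

namespace WeightedGraph

variable {V W : Type*}

/-- The weighted graph induced on `V` by an injective map into the vertices of `H`. -/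
def comap (H : WeightedGraph W) (f : V → W) : WeightedGraph V where
  graph := H.graph.comap f
  weight := fun e => H.weight (e.map f)
  weight_pos := Sym2.ind fun _ _ h => H.weight_pos _ h

variable (H : WeightedGraph W) {f : V → W}

/-- The homomorphism underlying an induced weighted graph. -/
def comapHom (f : V → W) : (H.comap f).graph →g H.graph := ⟨f, id⟩

theorem comap_walkLength_map {u v : V} (p : (H.comap f).graph.Walk u v) :
    H.walkLength (p.map (H.comapHom f)) = (H.comap f).walkLength p := by
  rw [walkLength, walkLength, SimpleGraph.Walk.edges_map, List.map_map]
  rfl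

theorem exists_comap_walk (hclosed : ∀ v w, H.graph.Adj (f v) w → w ∈ Set.range f) {a b : W}
    (p : H.graph.Walk a b) (u : V) (hu : f u = a) :
    ∃ (v : V) (hv : f v = b) (q : (H.comap f).graph.Walk u v),
      (q.map (H.comapHom f)).copy hu hv = p := by
  induction p generalizing u with
  | nil =>
    subst hu
    exact ⟨u, rfl, .nil, rfl⟩
  | @cons a y b e p ih =>
    subst hu
    obtain ⟨z, rfl⟩ := hclosed _ _ e
    obtain ⟨v, rfl, q, rfl⟩ := ih z rfl
    exact ⟨v, rfl, .cons e q, rfl⟩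

/-- Counts of shortest paths do not change when isolated vertices are added or removed. -/
theorem comap_numShortestPaths (hf : Function.Injective f)
    (hclosed : ∀ v w, H.graph.Adj (f v) w → w ∈ Set.range f) (u v : V) :
    (H.comap f).numShortestPaths u v = H.numShortestPaths (f u) (f v) := by
  have hlift : ∀ p : H.graph.Walk (f u) (f v), ∃ q : (H.comap f).graph.Walk u v,
      q.map (H.comapHom f) = p := by
    intro p
    obtain ⟨v', hv, q, hq⟩ := H.exists_comap_walk hclosed p u rfl
    obtain rfl := hf hv
    exact ⟨q, hq⟩
  refine Set.ncard_congr (fun p _ => p.map (H.comapHom f)) (fun p hp => ?_)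
    (fun p q _ _ h => SimpleGraph.Walk.map_injective_of_injective hf u v h) fun p hp => ?_
  · refine H.mem_shortestPaths_iff.2 fun q => ?_
    obtain ⟨q, rfl⟩ := hlift q
    exact ((H.comap_walkLength_map p).trans_le
      ((H.comap f).mem_shortestPaths_iff.1 hp q)).trans_eq (H.comap_walkLength_map q).symm
  · obtain ⟨q, rfl⟩ := hlift p
    refine ⟨q, (H.comap f).mem_shortestPaths_iff.2 fun q' => ?_, rfl⟩
    rw [← comap_walkLength_map, ← comap_walkLength_map]
    exact H.mem_shortestPaths_iff.1 hp _

end WeightedGraph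

/-! ### The gadget grid on `n` vertices and the encoding of messages. -/

namespace GadgetGrid

/-- The vertices of the gadget grid, enumerated row by row. -/
def coords (k r : ℕ) (u : ℕ) : ℕ × ℕ × ℕ :=
  (u / (2 * r + 1) / (k + 1), u / (2 * r + 1) % (k + 1), u % (2 * r + 1))

theorem coords_injective (k r : ℕ) : Function.Injective (coords k r) := by
  intro u v h
  simp only [coords, Prod.mk.injEq] at h
  obtain ⟨h1, h2, h3⟩ := h
  have h4 : u / (2 * r + 1) = v / (2 * r + 1) := by
    rw [← Nat.div_add_mod (u / (2 * r + 1)) (k + 1), h1, h2, Nat.div_add_mod]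
  rw [← Nat.div_add_mod u (2 * r + 1), h4, h3, Nat.div_add_mod]

theorem exists_coords_eq {k r n : ℕ} (hn : (k + 1) * (k + 1) * (2 * r + 1) ≤ n) {i j a : ℕ}
    (hi : i ≤ k) (hj : j ≤ k) (ha : a ≤ 2 * r) : ∃ u : Fin n, coords k r u = (i, j, a) := by
  have h1 : i * (k + 1) + j < (k + 1) * (k + 1) := by nlinarith
  have h2 : (2 * r + 1) * (i * (k + 1) + j) + a < n := by nlinarith
  refine ⟨⟨_, h2⟩, ?_⟩
  have e1 : ((2 * r + 1) * (i * (k + 1) + j) + a) / (2 * r + 1) = i * (k + 1) + j := by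
    rw [Nat.mul_add_div (by omega), Nat.div_eq_of_lt (by omega), add_zero]
  simp only [coords, e1, Prod.mk.injEq]
  refine ⟨?_, ?_, ?_⟩
  · rw [mul_comm, Nat.mul_add_div (by omega), Nat.div_eq_of_lt (by omega), add_zero]
  · rw [mul_comm, Nat.mul_add_mod, Nat.mod_eq_of_lt (by omega)]
  · rw [Nat.mul_add_mod, Nat.mod_eq_of_lt (by omega)]

/-- The gadget grid as a graph on `n` vertices. -/
def finGrid (n k r : ℕ) (x : ℕ → ℕ → ℕ) : WeightedGraph (Fin n) :=
  (grid k r x).comap fun u : Fin n => coords k r u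

variable {n k r : ℕ} {x : ℕ → ℕ → ℕ}

theorem finGrid_numShortestPaths (hn : (k + 1) * (k + 1) * (2 * r + 1) ≤ n) (u v : Fin n) :
    (finGrid n k r x).numShortestPaths u v =
      (grid k r x).numShortestPaths (coords k r u) (coords k r v) := by
  refine (grid k r x).comap_numShortestPaths
    ((coords_injective k r).comp Fin.val_injective) (fun v w h => ?_) u v
  obtain ⟨i, j, a⟩ := w
  obtain ⟨hi, hj, ha, -⟩ := bounds_of_adj h.symm
  exact exists_coords_eq hn hi hj ha

theorem finGrid_isPlanarWithCountBits {L : ℕ} (hn : (k + 1) * (k + 1) * (2 * r + 1) ≤ n)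
    (hL : r = 0 ∧ 2 ≤ L ∨ 3 * r + 6 ≤ L) (hx : ∀ i j, x i j < 2 ^ (r + 1))
    (hx' : 0 < r → ∀ i j, 2 ^ r ≤ x i j) : (finGrid n k r x).IsPlanarWithCountBits L := by
  refine ⟨isPlanar_comap _ ((coords_injective k r).comp Fin.val_injective) fun v => ?_,
    fun u v => ?_⟩
  · exact Nat.le_of_lt_succ (Nat.mod_lt _ (by omega))
  · rw [finGrid_numShortestPaths hn]
    exact numShortestPaths_lt hL hx hx' _ _

/-- The numbers encoded by the cells of the gadget grid for a given message. -/
def cellNumbers (k r : ℕ) (X : Fin k × Fin k → Fin (2 ^ max 1 r)) (i j : ℕ) : ℕ :=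
  -- For `r > 0` the leading digit is fixed to one, leaving `r` free bits. For `r = 0` the single
  -- digit is itself free, whence `max 1 r` bits per cell.
  (if r = 0 then 0 else 2 ^ r) + if h : i < k ∧ j < k then (X (⟨i, h.1⟩, ⟨j, h.2⟩) : ℕ) else 0

theorem cellNumbers_lt (X : Fin k × Fin k → Fin (2 ^ max 1 r)) (i j : ℕ) :
    cellNumbers k r X i j < 2 ^ (r + 1) := by
  have key : ∀ y < 2 ^ max 1 r, (if r = 0 then 0 else 2 ^ r) + y < 2 ^ (r + 1) := by
    intro y hy
    rcases Nat.eq_zero_or_pos r with rfl | hr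
    · simpa using hy
    · rw [max_eq_right (show 1 ≤ r from hr)] at hy
      rw [if_neg hr.ne', pow_succ]
      omega
  refine key _ ?_
  split_ifs
  · exact (X _).2
  · positivity

theorem le_cellNumbers (hr : 0 < r) (X : Fin k × Fin k → Fin (2 ^ max 1 r)) (i j : ℕ) :
    2 ^ r ≤ cellNumbers k r X i j := by
  rw [cellNumbers, if_neg hr.ne']
  exact Nat.le_add_right _ _

theorem cellNumbers_inj {X Y : Fin k × Fin k → Fin (2 ^ max 1 r)} {i j : Fin k}
    (h : cellNumbers k r X i j = cellNumbers k r Y i j) : X (i, j) = Y (i, j) := by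
  rw [cellNumbers, cellNumbers, Nat.add_left_cancel_iff, dif_pos ⟨i.2, j.2⟩,
    dif_pos ⟨i.2, j.2⟩] at h
  exact Fin.ext h

end GadgetGrid

/-! ### The information-theoretic bound. -/

/-- The number of bit strings of length at most `m`. -/
theorem natCard_list_bool_le (m : ℕ) : Nat.card {l : List Bool // l.length ≤ m} ≤ 4 ^ m := by
  have hinj : Function.Injective
      (fun (l : {l : List Bool // l.length ≤ m}) (t : Fin m) => l.1[(t : ℕ)]?) := by
    intro l l' h
    refine Subtype.ext (List.ext_getElem? fun t => ?_)
    rcases lt_or_ge t m with ht | ht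
    · exact congrFun h ⟨t, ht⟩
    · rw [List.getElem?_eq_none (l.2.trans ht), List.getElem?_eq_none (l'.2.trans ht)]
  -- A string padded with `none` is a function into three values, and `3 ^ m ≤ 4 ^ m`.
  refine (Nat.card_le_card_of_injective _ hinj).trans ?_
  rw [Nat.card_eq_fintype_card]
  simp only [Fintype.card_pi, Fintype.card_option, Fintype.card_bool, Finset.prod_const,
    Finset.card_univ, Fintype.card_fin]
  exact Nat.pow_le_pow_left (by norm_num) m

namespace CountingLabelingScheme

variable {n L : ℕ} (S : CountingLabelingScheme n L)

open GadgetGrid in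
/-- The information-theoretic bound given by the gadget grid. -/
theorem max_mul_le_of_length_le {k r m : ℕ} (hk : 0 < k)
    (hn : (k + 1) * (k + 1) * (2 * r + 1) ≤ n) (hL : r = 0 ∧ 2 ≤ L ∨ 3 * r + 6 ≤ L)
    (hm : ∀ G : WeightedGraph (Fin n), G.IsPlanarWithCountBits L →
      ∀ u, (S.label G u).length ≤ m) :
    max 1 r * k ≤ 4 * m := by
  set G : (Fin k × Fin k → Fin (2 ^ max 1 r)) → WeightedGraph (Fin n) :=
    fun X => finGrid n k r (cellNumbers k r X) with hG
  have hvalid : ∀ X, (G X).IsPlanarWithCountBits L := fun X =>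
    finGrid_isPlanarWithCountBits hn hL (cellNumbers_lt X) fun hr => le_cellNumbers hr X
  -- Sources are taken in the first column and targets in the last row, so that each pair reads the
  -- cell in the row of the source and just left of the column of the target.
  choose a ha using fun i : Fin k => exists_coords_eq hn (i := i) (j := 0) (a := 0)
    i.2.le (by omega) (by omega)
  choose b hb using fun j : Fin k => exists_coords_eq hn (i := k) (j := j + 1) (a := 0)
    le_rfl j.2 (by omega)
  have hcount : ∀ X i j, (G X).numShortestPaths (a i) (b j) = cellNumbers k r X i j + 1 := by
    intro X i j
    rw [hG, finGrid_numShortestPaths hn, ha, hb]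
    obtain ⟨k, rfl⟩ : ∃ t, k = t + 1 := ⟨k - 1, by omega⟩
    exact numShortestPaths_lower_right (by omega) (by omega) (by omega) (by omega)
      (cellNumbers_lt X i j)
  set F : (Fin k × Fin k → Fin (2 ^ max 1 r)) →
      (Fin k → {l : List Bool // l.length ≤ m}) × (Fin k → {l : List Bool // l.length ≤ m}) :=
    fun X => (fun i => ⟨S.label (G X) (a i), hm _ (hvalid X) _⟩,
      fun j => ⟨S.label (G X) (b j), hm _ (hvalid X) _⟩) with hF
  have hinj : Function.Injective F := by
    intro X Y h
    funext ⟨i, j⟩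
    have h1 : S.label (G X) (a i) = S.label (G Y) (a i) :=
      congrArg Subtype.val (congrFun (congrArg Prod.fst h) i)
    have h2 : S.label (G X) (b j) = S.label (G Y) (b j) :=
      congrArg Subtype.val (congrFun (congrArg Prod.snd h) j)
    have h3 := S.correct _ (hvalid X) (a i) (b j)
    rw [h1, h2, S.correct _ (hvalid Y), hcount, hcount] at h3
    exact (cellNumbers_inj (by omega)).symm
  have hfin : Finite {l : List Bool // l.length ≤ m} := List.finite_length_le Bool m
  have hcard := Nat.card_le_card_of_injective F hinj
  have hbound : Nat.card ((Fin k → {l : List Bool // l.length ≤ m}) ×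
      (Fin k → {l : List Bool // l.length ≤ m})) ≤ 2 ^ (4 * m * k) := by
    rw [Nat.card_prod, Nat.card_fun, Nat.card_fin]
    calc _ ≤ (4 ^ m) ^ k * (4 ^ m) ^ k := by
          gcongr <;> exact natCard_list_bool_le m
      _ = 2 ^ (4 * m * k) := by
          rw [show (4 : ℕ) = 2 ^ 2 by norm_num, ← pow_mul, ← pow_mul, ← pow_add]
          congr 1
          ring
  rw [Nat.card_fun, Nat.card_prod, Nat.card_fin, Nat.card_fin, ← pow_mul] at hcard
  have h := (Nat.pow_le_pow_iff_right one_lt_two).1 (hcard.trans hbound)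
  exact Nat.le_of_mul_le_mul_right (by rwa [mul_assoc]) hk

/-- Labels cannot all be empty. -/
theorem exists_label_ne_nil (hn : 2 ≤ n) (hL : 1 ≤ L) :
    ∃ G : WeightedGraph (Fin n), G.IsPlanarWithCountBits L ∧ ∃ u, S.label G u ≠ [] := by
  by_contra! h
  set G : WeightedGraph (Fin n) := ⟨⊥, fun _ => 1, fun _ _ => one_pos⟩ with hG
  have hplanar : IsPlanar G.graph := by
    refine isPlanar_of_separated _ (fun v => ((v : ℤ), 0)) (fun u v h => ?_)
      (fun u v _ _ h => absurd h (by simp [hG])) fun u v _ h => absurd h (by simp [hG])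
    simpa [Fin.ext_iff] using h
  have hvalid : G.IsPlanarWithCountBits L := ⟨hplanar, fun u v =>
    (G.numShortestPaths_le_one_of_isolated (by simp [hG])).trans_lt
      (Nat.one_lt_two_pow (by omega))⟩
  -- In the edgeless graph, empty labels would have to decode both to `1`, for a vertex and itself,
  -- and to `0`, for two different vertices.
  have h1 := S.correct G hvalid ⟨0, by omega⟩ ⟨0, by omega⟩
  have h2 := S.correct G hvalid ⟨0, by omega⟩ ⟨1, by omega⟩
  rw [G.numShortestPaths_self, h G hvalid] at h1
  rw [G.numShortestPaths_eq_zero, h G hvalid, h G hvalid, h1] at h2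
  · exact one_ne_zero h2
  · refine ⟨fun p => ?_⟩
    cases p with
    | cons e _ => simp [hG] at e

end CountingLabelingScheme

/-! ### Choice of the parameters. -/

theorem theorem5p1 :
    ∃ c : ℝ, 0 < c ∧ ∀ n L : ℕ, 2 ≤ L → L ≤ n → ∀ S : CountingLabelingScheme n L,
      ∃ G : WeightedGraph (Fin n), G.IsPlanarWithCountBits L ∧
        ∃ u : Fin n, c * Real.sqrt ((n : ℝ) * (L : ℝ)) ≤ ((S.label G u).length : ℝ) := by
  refine ⟨1 / 200, by norm_num, fun n L hL hLn S => ?_⟩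
  have hLn' : (L : ℝ) ≤ n := by exact_mod_cast hLn
  -- For small `n` the bound is below one bit, and a nonempty label suffices.
  rcases lt_or_ge n 12 with hn | hn
  · obtain ⟨G, hG, u, hu⟩ := S.exists_label_ne_nil (by omega) (by omega)
    refine ⟨G, hG, u, ?_⟩
    have h1 : (1 : ℝ) ≤ (S.label G u).length := by
      exact_mod_cast List.length_pos_iff.2 hu
    have hn' : (n : ℝ) ≤ 12 := by exact_mod_cast hn.le
    have h2 : Real.sqrt ((n : ℝ) * L) ≤ 12 := by
      rw [Real.sqrt_le_left (by norm_num)]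
      nlinarith [Nat.cast_nonneg (α := ℝ) n, Nat.cast_nonneg (α := ℝ) L]
    linarith
  · by_contra! h
    -- Dividing by `12` rather than `3` also gives `12 * ρ ≤ n`, so that `k` is positive; truncation
    -- makes `r = 0` for `L < 18`.
    set r := (L - 6) / 12 with hr
    set ρ := max 1 r with hρ
    set k := Nat.sqrt (n / (12 * ρ)) with hk
    set s := Real.sqrt ((n : ℝ) * L) with hs
    have hρ1 : 1 ≤ ρ := le_max_left _ _
    have hkpos : 0 < k := by
      rw [hk, Nat.sqrt_pos]
      exact Nat.div_pos (by omega) (by omega)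
    have hk1 : k * k * (12 * ρ) ≤ n :=
      (Nat.mul_le_mul_right _ (Nat.sqrt_le _)).trans (Nat.div_mul_le_self _ _)
    have hk2 : n < 48 * ρ * (k * k) := by
      have h1 : n / (12 * ρ) < (k + 1) * (k + 1) := Nat.lt_succ_sqrt _
      have h2 := (Nat.div_lt_iff_lt_mul (by omega)).1 h1
      have h3 : (k + 1) * (k + 1) ≤ 4 * (k * k) := by nlinarith
      nlinarith
    -- `L ≤ 12 * r + 17`, and `29 = 12 + 17`.
    have hLρ : L ≤ 29 * ρ := by omega
    have hsize : (k + 1) * (k + 1) * (2 * r + 1) ≤ n := by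
      have h3 : (k + 1) * (k + 1) ≤ 4 * (k * k) := by nlinarith
      have h4 : 2 * r + 1 ≤ 3 * ρ := by omega
      calc _ ≤ 4 * (k * k) * (3 * ρ) := Nat.mul_le_mul h3 h4
        _ = k * k * (12 * ρ) := by ring
        _ ≤ n := hk1
    have hs0 : 0 ≤ s := Real.sqrt_nonneg _
    have key := S.max_mul_le_of_length_le (m := ⌊1 / 200 * s⌋₊) hkpos hsize (by omega)
      fun G hG u => Nat.le_floor (h G hG u).le
    have hfloor : ((⌊1 / 200 * s⌋₊ : ℕ) : ℝ) ≤ 1 / 200 * s := Nat.floor_le (by positivity)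
    have key' : ((ρ * k : ℕ) : ℝ) ≤ 4 * (1 / 200 * s) := by
      refine (Nat.cast_le.2 key).trans ?_
      push_cast
      linarith
    have hss : s * s = n * L := Real.mul_self_sqrt (by positivity)
    -- `1392 = 48 * 29`. The contradiction arises because `ρ * k ≤ s / 50` and `1392 < 50 ^ 2`.
    have hnL : ((n * L : ℕ) : ℝ) < ((1392 * ((ρ * k) * (ρ * k)) : ℕ) : ℝ) := by
      refine Nat.cast_lt.2 ?_
      calc n * L < 48 * ρ * (k * k) * L := Nat.mul_lt_mul_of_pos_right hk2 (by omega)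
        _ ≤ 48 * ρ * (k * k) * (29 * ρ) := Nat.mul_le_mul_left _ hLρ
        _ = _ := by ring
    have hsq := mul_self_le_mul_self (Nat.cast_nonneg (α := ℝ) (ρ * k)) key'
    push_cast at hnL hsq
    nlinarith
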